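/- Let $V=(V,Y,\mathbf 1,\omega)$ be a vertex operator algebra over $\mathbb C$ of central charge $c$, with $Y(a,z)=\sum_{n\in\mathbb Z}a_nz^{-n-1}$, $L(n)=\omega_{n+1}$ and $V=\bigoplus_n V_n$ the grading by $L(0)$-eigenvalues. Assume that $V$ is strongly rational, that is: - $V$ is of strong CFT type: $V_n=0$ for $n<0$, $V_0=\mathbb C\mathbf 1$ and $L(1)V_1=0$; - $V$ is rational: every admissible ($\mathbb Z_{\ge 0}$-graded) $V$-module is a direct sum of irreducible admissible $V$-modules; - $V$ is $C_2$-cofinite: the span of all $a_{-2}b$ with $a,b\in V$ has finite codimension in $V$. Let $\mathfrak h$ be a Cartan subalgebra of the Lie algebra $V_1$, whose bracket is $[a,b]=a_0b$. Let $M$ be an irreducible (ordinary) $V$-module, with $L(0)$-eigenspace decomposition $M=\bigoplus_{\lambda\in\mathbb C}M_\lambda$, $\dim M_\lambda<\infty$. For $v\in V_1$ let $o(v)=v_0$ act on $M$; it preserves each $M_\lambda$. Put $$\chi_M(v,\tau)=\mathrm{Tr}_M\, e^{2\pi i\,o(v)}q^{L(0)-c/24}=\sum_{\lambda\in\mathbb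 C}\bigl(\mathrm{Tr}_{M_\lambda}e^{2\pi i\, o(v)}\bigr)\,e^{2\pi i\tau(\lambda-c/24)},\qquad q=e^{2\pi i\tau}.$$ Then this series converges absolutely for all $v\in\mathfrak h$ and all $\tau\in\mathbb H=\{\tau\in\mathbb C:\mathrm{Im}\,\tau>0\}$, and its sum $\chi_M(v,\tau)$ is a holomorphic function on $\mathfrak h\times\mathbb H$. -/

import Mathlib

open VertexOperator

noncomputable section

universe u v

/-- The Jacobi identity, written through the coefficients of `z₀^(-l-1) z₁^(-m-1) z₂^(-n-1)`:
`Y` is the vertex operator map of the algebra and `YM` that of the module.  Every sum has only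
finitely many nonzero terms, because vertex operators take values in Laurent series. -/
def JacobiIdentity {V : Type u} {M : Type v} [AddCommGroup V] [Module ℂ V] [AddCommGroup M]
    [Module ℂ M] (Y : V →ₗ[ℂ] VertexOperator ℂ V) (YM : V →ₗ[ℂ] VertexOperator ℂ M) : Prop :=
  ∀ (a b : V) (w : M) (l m n : ℤ),
    ∑ᶠ j : ℕ, Ring.choose m j • ncoeff (YM (ncoeff (Y a) (l + j) b)) (m + n - j) w =
    ∑ᶠ j : ℕ, ((-1) ^ j * Ring.choose l j) •
      (ncoeff (YM a) (m + l - j) (ncoeff (YM b) (n + j) w) -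
        (l.negOnePow : ℤ) • ncoeff (YM b) (l + n - j) (ncoeff (YM a) (m + j) w))

/-- A vertex operator algebra over `ℂ`.  The coefficient `ncoeff (Y a) n` is the mode `aₙ` in
`Y(a, z) = ∑ aₙ z^(-n-1)`, the operator `L(n)` is `ω_{n+1}`, and the homogeneous subspace `V_n`
is the eigenspace of `L(0)` for the eigenvalue `n`. -/
class VertexOperatorAlgebra (V : Type u) [AddCommGroup V] [Module ℂ V] where
  /-- the vertex operators; `aₙ b = 0` for large `n` holds because the values are Laurent series -/
  Y : V →ₗ[ℂ] VertexOperator ℂ V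
  /-- the vacuum vector -/
  vacuum : V
  /-- the conformal (Virasoro) vector -/
  conformal : V
  /-- the central charge, also called the rank -/
  centralCharge : ℂ
  vacuum_mode : ∀ n : ℤ, ncoeff (Y vacuum) n = if n = -1 then 1 else 0
  creation_nonneg : ∀ (a : V) (n : ℤ), 0 ≤ n → ncoeff (Y a) n vacuum = 0
  creation : ∀ a : V, ncoeff (Y a) (-1) vacuum = a
  jacobi : JacobiIdentity Y Y
  virasoro : ∀ m n : ℤ,
    ncoeff (Y conformal) (m + 1) * ncoeff (Y conformal) (n + 1) -
        ncoeff (Y conformal) (n + 1) * ncoeff (Y conformal) (m + 1) =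
      ((m : ℂ) - n) • ncoeff (Y conformal) (m + n + 1) +
        (if m + n = 0 then ((m : ℂ) ^ 3 - m) / 12 * centralCharge else 0) •
          (1 : Module.End ℂ V)
  translation : ∀ (a : V) (n : ℤ),
    ncoeff (Y (ncoeff (Y conformal) 0 a)) n = (-n : ℂ) • ncoeff (Y a) (n - 1)
  graded : DirectSum.IsInternal fun n : ℤ =>
    Module.End.eigenspace (ncoeff (Y conformal) 1) (n : ℂ)
  finite_graded : ∀ n : ℤ,
    Module.Finite ℂ (Module.End.eigenspace (ncoeff (Y conformal) 1) (n : ℂ))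
  bounded_below : ∃ N : ℤ, ∀ n < N,
    Module.End.eigenspace (ncoeff (Y conformal) 1) (n : ℂ) = ⊥
  vacuum_weight : vacuum ∈ Module.End.eigenspace (ncoeff (Y conformal) 1) 0
  conformal_weight : conformal ∈ Module.End.eigenspace (ncoeff (Y conformal) 1) 2

/-- A module for a vertex operator algebra, without any grading (a weak module). -/
class VOAModule (V : Type u) (M : Type v) [AddCommGroup V] [Module ℂ V]
    [VertexOperatorAlgebra V] [AddCommGroup M] [Module ℂ M] where
  YM : V →ₗ[ℂ] VertexOperator ℂ M
  vacuum_mode : ∀ n : ℤ,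
    ncoeff (YM (VertexOperatorAlgebra.vacuum : V)) n = if n = -1 then 1 else 0
  jacobi : JacobiIdentity (VertexOperatorAlgebra.Y : V →ₗ[ℂ] VertexOperator ℂ V) YM

namespace VOA

open VertexOperatorAlgebra

variable {V : Type u} [AddCommGroup V] [Module ℂ V] [VertexOperatorAlgebra V]

variable (V) in
/-- A vertex operator algebra is a module for itself. -/
instance : VOAModule V V where
  YM := Y
  vacuum_mode := vacuum_mode
  jacobi := jacobi

variable (M : Type v) [AddCommGroup M] [Module ℂ M] [VOAModule V M]

/-- The mode `aₙ` acting on the module `M`. -/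
def mode (a : V) (n : ℤ) : Module.End ℂ M := ncoeff (VOAModule.YM (M := M) a) n

variable (V) in
/-- The Virasoro operator `L(n) = ω_{n+1}` on the module `M`. -/
def L (n : ℤ) : Module.End ℂ M := mode M (conformal : V) (n + 1)

variable (V) in
/-- The weight space `M_μ = {w | L(0) w = μ w}`. -/
def weightSpace (μ : ℂ) : Submodule ℂ M := Module.End.eigenspace (L V M 0) μ

variable (V) in
/-- The homogeneous subspace `V_n`. -/
abbrev homogeneous (n : ℤ) : Submodule ℂ V := weightSpace V V (n : ℂ)

/-! ### Commutators and weights -/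

variable {M}

theorem mem_weightSpace {μ : ℂ} {w : M} : w ∈ weightSpace V M μ ↔ L V M 0 w = μ • w :=
  Module.End.mem_eigenspace_iff

theorem jacobi_mode (a b : V) (w : M) (l m n : ℤ) :
    ∑ᶠ j : ℕ, Ring.choose m j • mode M (mode V a (l + j) b) (m + n - j) w =
    ∑ᶠ j : ℕ, ((-1) ^ j * Ring.choose l j) •
      (mode M a (m + l - j) (mode M b (n + j) w) -
        (l.negOnePow : ℤ) • mode M b (l + n - j) (mode M a (m + j) w)) :=
  VOAModule.jacobi (V := V) (M := M) a b w l m n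

theorem mode_vacuum (n : ℤ) :
    mode M (vacuum : V) n = if n = -1 then 1 else 0 :=
  VOAModule.vacuum_mode n

theorem mode_add (a b : V) (n : ℤ) : mode M (a + b) n = mode M a n + mode M b n := by
  simp [mode]

theorem mode_smul (r : ℂ) (a : V) (n : ℤ) : mode M (r • a) n = r • mode M a n := by
  simp [mode]

theorem mode_zero (n : ℤ) : mode M (0 : V) n = 0 := by
  simp [mode]

theorem L_neg_one (a : V) : L V V (-1) a = mode V a (-2) vacuum := by
  have h : mode V (L V V (-1) a) (-1) vacuum = ((-(-1 : ℤ) : ℂ) • mode V a (-1 - 1)) vacuum :=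
    congrArg (fun f : Module.End ℂ V => f vacuum) (translation a (-1))
  have h' : mode V (L V V (-1) a) (-1) vacuum = L V V (-1) a := creation _
  rw [h'] at h
  simpa using h

/-- The translation property on modules. -/
theorem mode_translation (a : V) (n : ℤ) :
    mode M (L V V (-1) a) n = (-n : ℂ) • mode M a (n - 1) := by
  ext w
  have h := jacobi_mode a (vacuum : V) w (-2) 0 n
  rw [finsum_eq_single _ 0 (fun j hj => by
    rw [Ring.choose_zero_pos ℤ (Nat.pos_of_ne_zero hj), zero_smul])] at h
  have hc : ∀ j : ℕ, (-1) ^ j * Ring.choose (-2 : ℤ) j = j + 1 := by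
    intro j
    have h2 : Ring.choose (2 + (j : ℤ) - 1) j = j + 1 := by
      rw [show (2 + (j : ℤ) - 1) = ((j + 1 : ℕ) : ℤ) by push_cast; ring, Ring.choose_natCast,
        Nat.choose_succ_self_right]
      simp
    rw [Ring.choose_neg, h2, Int.negOnePow_def]
    rcases Nat.even_or_odd j with hj | hj <;> simp [hj.neg_one_pow, Units.smul_def, add_comm]
  simp only [hc, mode_vacuum, L_neg_one] at h ⊢
  have hs : ((-2 : ℤ).negOnePow : ℤ) = 1 := by decide
  rw [hs] at h
  simp only [Ring.choose_zero_right, one_smul, Nat.cast_zero, add_zero, zero_add, sub_zero] at h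
  rw [h]
  rcases lt_trichotomy n 0 with hn | hn | hn
  · obtain ⟨k, hk⟩ : ∃ k : ℕ, n = -1 - k := ⟨(-1 - n).toNat, by omega⟩
    rw [finsum_eq_single _ k]
    · rw [if_pos (by omega), if_neg (by omega)]
      subst hk
      simp only [Module.End.one_apply, LinearMap.zero_apply, sub_zero, LinearMap.smul_apply]
      rw [show (-2 - k : ℤ) = -1 - k - 1 by ring, ← Int.cast_smul_eq_zsmul ℂ]
      push_cast
      congr 1
      ring
    · intro j hj
      rw [if_neg (by omega), if_neg (by omega)]
      simp
  · subst hn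
    rw [finsum_eq_zero_of_forall_eq_zero]
    · simp
    · intro j
      rw [if_neg (by omega), if_neg (by omega)]
      simp
  · obtain ⟨k, hk⟩ : ∃ k : ℕ, n = k + 1 := ⟨(n - 1).toNat, by omega⟩
    rw [finsum_eq_single _ k]
    · rw [if_neg (by omega), if_pos (by omega)]
      subst hk
      simp only [Module.End.one_apply, LinearMap.zero_apply, map_zero, zero_sub,
        LinearMap.smul_apply]
      rw [show (k + 1 - 1 : ℤ) = k by ring, ← Int.cast_smul_eq_zsmul ℂ]
      push_cast
      rw [smul_neg, neg_smul]
    · intro j hj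
      rw [if_neg (by omega), if_neg (by omega)]
      simp

/-- The commutator of `L(0)` with a mode. -/
theorem L_zero_mode (a : V) (n : ℤ) (w : M) :
    L V M 0 (mode M a n w) =
      mode M a n (L V M 0 w) + mode M (L V V 0 a) n w - (n + 1 : ℂ) • mode M a n w := by
  have h := jacobi_mode (conformal : V) a w 0 1 n
  rw [finsum_eq_single (fun j : ℕ => ((-1) ^ j * Ring.choose (0 : ℤ) j) • _) 0 (fun j hj => by
    rw [Ring.choose_zero_pos ℤ (Nat.pos_of_ne_zero hj), mul_zero, zero_smul])] at h
  rw [finsum_eq_sum_of_support_subset (s := Finset.range 2)] at h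
  · simp only [Finset.sum_range_succ, Finset.sum_range_zero] at h
    have h1 : mode M (mode V (conformal : V) 0 a) (1 + n) w = -(n + 1 : ℂ) • mode M a n w := by
      have := congrArg (fun f : Module.End ℂ M => f w) (mode_translation (M := M) a (1 + n))
      simp only [L, LinearMap.smul_apply] at this
      rw [show (1 + n - 1 : ℤ) = n by ring, show (-1 + 1 : ℤ) = 0 by ring] at this
      rw [this]
      push_cast
      congr 1
      ring
    simp [h1] at h
    simp only [L, zero_add]
    rw [sub_eq_iff_eq_add'.mp h.symm]
    module
  · intro j hj
    simp only [Finset.coe_range, Set.mem_Iio]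
    by_contra hlt
    apply hj
    have : Ring.choose (1 : ℤ) j = 0 := by
      have := Ring.choose_natCast (R := ℤ) 1 j
      rw [Nat.choose_eq_zero_of_lt (by omega)] at this
      simpa using this
    simp [this]

/-- `aₙ M_μ ⊆ M_{μ + wt a - n - 1}` for homogeneous `a`. -/
theorem mode_mem_weightSpace {a : V} {k μ : ℂ} {w : M} (ha : a ∈ weightSpace V V k)
    (hw : w ∈ weightSpace V M μ) (n : ℤ) :
    mode M a n w ∈ weightSpace V M (μ + k - n - 1) := by
  rw [mem_weightSpace] at *
  rw [L_zero_mode, ha, hw, mode_smul, map_smul, LinearMap.smul_apply]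
  module

/-! ### Vertex operator algebras of CFT type and the Lie algebra of weight one -/

variable (V) in
/-- CFT type: `V = ⨁_{n ≥ 0} V_n` and `V_0 = ℂ 𝟏`. -/
class IsCFTType : Prop where
  homogeneous_neg : ∀ n : ℤ, n < 0 → homogeneous V n = ⊥
  homogeneous_zero : homogeneous V 0 = Submodule.span ℂ {vacuum}

variable (V) in
/-- Strong CFT type: CFT type and `L(1) V_1 = 0`. -/
class IsStrongCFTType : Prop extends IsCFTType V where
  L_one : ∀ a ∈ homogeneous V 1, L V V 1 a = 0

theorem zero_mode_mem {a b : V} (ha : a ∈ homogeneous V 1) (hb : b ∈ homogeneous V 1) :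
    mode V a 0 b ∈ homogeneous V 1 := by
  have h := mode_mem_weightSpace ha hb 0
  have e : (((1 : ℤ) : ℂ) + ((1 : ℤ) : ℂ) - ((0 : ℤ) : ℂ) - 1) = ((1 : ℤ) : ℂ) := by simp
  rwa [e] at h

theorem zero_mode_skew [IsCFTType V] {a b : V} (ha : a ∈ homogeneous V 1)
    (hb : b ∈ homogeneous V 1) : mode V a 0 b = -mode V b 0 a := by
  have h := jacobi_mode a b (vacuum : V) 0 (-1) 0
  rw [finsum_eq_single (fun j : ℕ => ((-1) ^ j * Ring.choose (0 : ℤ) j) • _) 0 (fun j hj => by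
    rw [Ring.choose_zero_pos ℤ (Nat.pos_of_ne_zero hj), mul_zero, zero_smul])] at h
  rw [finsum_eq_single _ 0] at h
  · have c1 : mode V (mode V a 0 b) (-1) vacuum = mode V a 0 b := creation _
    have c2 : mode V b 0 vacuum = 0 := creation_nonneg _ _ le_rfl
    have c3 : mode V a (-1) vacuum = a := creation _
    simpa [c1, c2, c3] using h
  · intro j hj
    obtain ⟨k, rfl⟩ := Nat.exists_eq_succ_of_ne_zero hj
    have hm := mode_mem_weightSpace ha hb (k + 1 : ℕ)
    have e : (((1 : ℤ) : ℂ) + ((1 : ℤ) : ℂ) - (((k + 1 : ℕ) : ℤ) : ℂ) - 1) =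
        ((-k : ℤ) : ℂ) := by push_cast; ring
    rw [e] at hm
    have hz : mode V (mode V a (k + 1 : ℕ) b) (-1 + 0 - (k + 1 : ℕ)) (vacuum : V) = 0 := by
      rcases Nat.eq_zero_or_pos k with rfl | hk
      · change _ ∈ homogeneous V (-((0 : ℕ) : ℤ)) at hm
        rw [Nat.cast_zero, neg_zero, IsCFTType.homogeneous_zero,
          Submodule.mem_span_singleton] at hm
        obtain ⟨r, hr⟩ := hm
        rw [← hr, mode_smul, mode_vacuum, if_neg (by omega)]
        simp
      · change _ ∈ homogeneous V (-(k : ℤ)) at hm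
        rw [IsCFTType.homogeneous_neg _ (by omega), Submodule.mem_bot] at hm
        rw [hm, mode_zero, LinearMap.zero_apply]
    rw [zero_add]
    simp only [Nat.succ_eq_add_one]
    rw [hz, smul_zero]

theorem zero_mode_comm (a b : V) (w : M) :
    mode M (mode V a 0 b) 0 w = mode M a 0 (mode M b 0 w) - mode M b 0 (mode M a 0 w) := by
  have h := jacobi_mode a b w 0 0 0
  rw [finsum_eq_single _ 0 (fun j hj => by rw [Ring.choose_zero_pos ℤ (Nat.pos_of_ne_zero hj), zero_smul]),
    finsum_eq_single _ 0 (fun j hj => by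
      rw [Ring.choose_zero_pos ℤ (Nat.pos_of_ne_zero hj), mul_zero, zero_smul])] at h
  simpa using h

variable (V) in
/-- The weight one subspace `V_1`, a Lie algebra under `[a, b] = a₀ b`. -/
abbrev WeightOne : Type u := homogeneous V 1

instance [IsCFTType V] : LieRing (WeightOne V) where
  bracket a b := ⟨mode V (a : V) 0 (b : V), zero_mode_mem a.2 b.2⟩
  add_lie a b c := Subtype.ext (by simp [mode_add])
  lie_add a b c := Subtype.ext (by simp)
  lie_self a := Subtype.ext (by
    have h := zero_mode_skew a.2 a.2
    have : IsAddTorsionFree V := IsAddTorsionFree.of_isTorsionFree ℂ V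
    exact self_eq_neg.mp h)
  leibniz_lie a b c := Subtype.ext (by
    change mode V (a : V) 0 (mode V (b : V) 0 (c : V)) =
      mode V (mode V (a : V) 0 (b : V)) 0 (c : V) + mode V (b : V) 0 (mode V (a : V) 0 (c : V))
    rw [zero_mode_comm]
    abel)

instance [IsCFTType V] : LieAlgebra ℂ (WeightOne V) where
  lie_smul r a b := Subtype.ext (by
    change mode V (a : V) 0 (r • (b : V)) = r • mode V (a : V) 0 (b : V)
    rw [map_smul])

/-! ### Rationality -/

variable (V) (M)

variable {M} in
/-- `N` is a `V`-submodule: a subspace stable under all modes. -/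
def IsVSubmodule (N : Submodule ℂ M) : Prop :=
  ∀ (a : V) (n : ℤ), ∀ w ∈ N, mode M a n w ∈ N

/-- A grading `M = ⨁_{n ≥ 0} M(n)` that makes `M` an admissible module. -/
structure AdmissibleGrading where
  gr : ℤ → Submodule ℂ M
  internal : DirectSum.IsInternal gr
  gr_neg : ∀ n < 0, gr n = ⊥
  gr_zero : gr 0 ≠ ⊥
  mode_mem : ∀ (k : ℤ), ∀ a ∈ homogeneous V k, ∀ (m n : ℤ), ∀ w ∈ gr n,
    mode M a m w ∈ gr (k - m - 1 + n)

variable {V M} in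
/-- `N` is a graded submodule of the admissible module `M`, that is `N = ⨁ (N ∩ M(n))`.  After a
shift of the degrees a nonzero one is itself an admissible module. -/
def AdmissibleGrading.IsGradedSubmodule (g : AdmissibleGrading V M) (N : Submodule ℂ M) : Prop :=
  IsVSubmodule V N ∧ N = ⨆ n, N ⊓ g.gr n

variable {V M} in
/-- `N` is an irreducible admissible submodule of `M`. -/
def AdmissibleGrading.IsIrreducible (g : AdmissibleGrading V M) (N : Submodule ℂ M) : Prop :=
  g.IsGradedSubmodule N ∧ N ≠ ⊥ ∧ ∀ N' ≤ N, g.IsGradedSubmodule N' → N' = ⊥ ∨ N' = N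

/-- `V` is rational: every admissible module is a direct sum of irreducible admissible modules. -/
def IsRational (V : Type u) [AddCommGroup V] [Module ℂ V] [VertexOperatorAlgebra V] : Prop :=
  ∀ (W : Type u) [AddCommGroup W] [Module ℂ W] [VOAModule V W] (g : AdmissibleGrading V W),
    ∃ (ι : Type u) (N : ι → Submodule ℂ W),
      (∀ i, g.IsIrreducible (N i)) ∧ iSupIndep N ∧ ⨆ i, N i = ⊤

/-- `C_2(V)`, the span of all `a_{-2} b`. -/
def C₂ : Submodule ℂ V := Submodule.span ℂ {x | ∃ a b : V, x = mode V a (-2) b}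

/-- Strongly rational: of strong CFT type, rational and `C_2`-cofinite. -/
class IsStronglyRational : Prop extends IsStrongCFTType V where
  rational : IsRational V
  C₂_cofinite : Module.Finite ℂ (V ⧸ C₂ V)

/-! ### Ordinary modules and their characters -/

/-- An (ordinary) `V`-module: an admissible module that is the direct sum of its finite-dimensional
`L(0)`-eigenspaces `M_μ`, with `M_{μ+n} = 0` for every `μ` and all sufficiently small integers
`n`. -/
class IsOrdinaryModule : Prop where
  admissible : Nonempty (AdmissibleGrading V M)
  internal : DirectSum.IsInternal (weightSpace V M)
  finite_weightSpace : ∀ μ : ℂ, Module.Finite ℂ (weightSpace V M μ)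
  bounded_below : ∀ μ : ℂ, ∃ N : ℤ, ∀ n < N, weightSpace V M (μ + n) = ⊥

/-- `M` is irreducible: it is nonzero and has no submodules but `0` and `M`. -/
def IsIrreducibleModule : Prop :=
  Nontrivial M ∧ ∀ N : Submodule ℂ M, IsVSubmodule V N → N = ⊥ ∨ N = ⊤

instance [IsOrdinaryModule V M] (μ : ℂ) : Module.Finite ℂ (weightSpace V M μ) :=
  IsOrdinaryModule.finite_weightSpace μ

variable {V}

/-- `o(a) = a₀` for `a ∈ V_1`, as an operator on the weight space `M_μ`. -/
def zeroMode (a : WeightOne V) (μ : ℂ) : Module.End ℂ (weightSpace V M μ) :=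
  (mode M (a : V) 0).restrict fun w hw => by
    have h := mode_mem_weightSpace (M := M) a.2 hw 0
    have e : (μ + ((1 : ℤ) : ℂ) - ((0 : ℤ) : ℂ) - 1) = μ := by simp
    rwa [e] at h

/-- The exponential of an endomorphism of a finite-dimensional complex vector space, computed as a
matrix exponential. -/
def expEnd {E : Type v} [AddCommGroup E] [Module ℂ E] [Module.Finite ℂ E]
    (A : Module.End ℂ E) : Module.End ℂ E :=
  Matrix.toLin (Module.finBasis ℂ E) (Module.finBasis ℂ E)
    (NormedSpace.exp (LinearMap.toMatrix (Module.finBasis ℂ E) (Module.finBasis ℂ E) A))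

/-- The contribution of `M_μ` to `Tr_M e^{2πi o(a)} q^{L(0) - c/24}` with `q = e^{2πiτ}`. -/
def characterTerm [IsOrdinaryModule V M] (a : WeightOne V) (τ μ : ℂ) : ℂ :=
  LinearMap.trace ℂ (weightSpace V M μ)
      (expEnd ((2 * Real.pi * Complex.I : ℂ) • zeroMode M a μ)) *
    Complex.exp (2 * Real.pi * Complex.I * τ * (μ - centralCharge V / 24))

/-- The character `χ_M(a, τ) = Tr_M e^{2πi o(a)} q^{L(0) - c/24}`. -/
def character [IsOrdinaryModule V M] (a : WeightOne V) (τ : ℂ) : ℂ :=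
  ∑' μ : ℂ, characterTerm M a τ μ

end VOA

/-- `f` is holomorphic on `E × ℍ`, where `E` is a finite-dimensional complex vector space: it is
complex differentiable there in the coordinates of any basis of `E`. -/
def HolomorphicOnProdUpperHalfPlane {E : Type u} [AddCommGroup E] [Module ℂ E]
    (f : E → ℂ → ℂ) : Prop :=
  Module.Finite ℂ E ∧ ∀ (r : ℕ) (b : Module.Basis (Fin r) ℂ E),
    DifferentiableOn ℂ (fun p : (Fin r → ℂ) × ℂ => f (∑ i, p.1 i • b i) p.2) {p | 0 < p.2.im}

end

noncomputable section

universe u v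

/-! Two subexponential estimates carry the proof: one for the dimension of the weight spaces and one
for the eigenvalues of the zero modes on them. Against them stands the geometric decay of $|q|^n$.

Let $M_\mu$ be a lowest weight space of $M$. By irreducibility, $M$ is spanned by words in modes
applied to $M_\mu$. By $C_2$-cofiniteness there is a $K$ such that every $V_k$ with $k>K$ is spanned
by products $a_{-2}b$, and a mode of $a_{-2}b$ is a combination of products of modes of $a$ and $b$,
of total weight one less. Commutators also lower the total weight. Two letters of the same degree
$d$ can be separated: a mode of the normally ordered product $a_{-1}b$ is the sum of all products of
modes of $a$ and $b$ whose degrees have sum $2d$, so the product with both degrees $d$ is expressed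
by the others and by the single mode. Hence $M_{\mu+n}$ is spanned by words in vectors of weight at
most $K$ whose degrees are distinct, nonnegative and of sum $n$ (`wordOp_mem_reducedSpan`,
`exists_weightSpace_eq_reducedSpan`).

Distinct degrees of sum $n$ force the length of a word to be $O(\sqrt n)$. This bounds $\dim
M_{\mu+n}$ by $e^{O(\sqrt n\log n)}$ (`finrank_weightSpace_le`). For $a\in V_1$ the operator $a_0$
acts on words as a derivation that preserves the weights and degrees of the letters, so its
eigenvalues on $M_{\mu+n}$ are $O(\sqrt n)$ (`dualBound_reducedBasisWord`). The trace of the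
exponential on $M_{\mu+n}$ is therefore $e^{O(\sqrt n\log n)}$, with constants uniform for $a$ in
bounded sets. The terms of the series are holomorphic, and a locally uniform summable bound makes
the sum holomorphic (`differentiableOn_tsum_of_locally_bounded`). -/

theorem iSupIndep.eq_of_le_of_iSup_eq_top {R E ι : Type*} [Ring R] [AddCommGroup E] [Module R E]
    {A B : ι → Submodule R E} (hA : iSupIndep A) (hBA : ∀ i, B i ≤ A i) (hB : ⨆ i, B i = ⊤)
    (i : ι) : B i = A i := by
  refine le_antisymm (hBA i) ?_
  have h1 : B i ⊔ ⨆ (j) (_ : j ≠ i), A j = ⊤ := by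
    refine top_le_iff.mp (hB ▸ iSup_le fun j => ?_)
    by_cases hj : j = i
    · exact hj ▸ le_sup_left
    · exact le_sup_of_le_right ((hBA j).trans (le_iSup₂_of_le j hj le_rfl))
  -- The modular law: `A i` meets the sum of the other `A j` only in zero, so intersecting `h1` with
  -- `A i` leaves `B i`.
  have h2 := sup_inf_assoc_of_le (⨆ (j) (_ : j ≠ i), A j) (hBA i)
  rw [h1, top_inf_eq, inf_comm, (hA i).eq_bot, sup_bot_eq] at h2
  exact h2.le

namespace VOA

open VertexOperatorAlgebra

variable {V : Type u} [AddCommGroup V] [Module ℂ V] [VertexOperatorAlgebra V]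
variable {M : Type v} [AddCommGroup M] [Module ℂ M] [VOAModule V M]

/-! ### Modes and truncation -/

variable (M) in
/-- The modes `aₙ w` of a fixed vector, as a linear map in `a`. -/
def modeFlip (n : ℤ) (w : M) : V →ₗ[ℂ] M where
  toFun a := mode M a n w
  map_add' a b := by rw [mode_add, LinearMap.add_apply]
  map_smul' r a := by rw [mode_smul, LinearMap.smul_apply, RingHom.id_apply]

@[simp] theorem modeFlip_apply (n : ℤ) (w : M) (a : V) : modeFlip M n w a = mode M a n w := rfl

theorem exists_mode_eq_zero (a : V) (w : M) : ∃ N : ℤ, ∀ n, N ≤ n → mode M a n w = 0 := by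
  refine ⟨-HahnSeries.order ((HahnModule.of ℂ).symm (VOAModule.YM (M := M) a w)), fun n hn => ?_⟩
  exact ncoeff_eq_zero_of_lt_order _ _ _ (by omega)

theorem mode_mem_homogeneous {a b : V} {k h : ℤ} (ha : a ∈ homogeneous V k)
    (hb : b ∈ homogeneous V h) (n : ℤ) : mode V a n b ∈ homogeneous V (k + h - n - 1) := by
  have := mode_mem_weightSpace ha hb n
  rwa [show ((h : ℂ) + k - n - 1) = ((k + h - n - 1 : ℤ) : ℂ) by push_cast; ring] at this

theorem commutator_mode (a b : V) (w : M) (m n : ℤ) :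
    mode M a m (mode M b n w) - mode M b n (mode M a m w) =
      ∑ᶠ j : ℕ, Ring.choose m j • mode M (mode V a j b) (m + n - j) w := by
  have h := jacobi_mode a b w 0 m n
  rw [finsum_eq_single (fun j : ℕ => ((-1) ^ j * Ring.choose (0 : ℤ) j) • _) 0 (fun j hj => by
    rw [Ring.choose_zero_pos ℤ (Nat.pos_of_ne_zero hj), mul_zero, zero_smul])] at h
  simpa using h.symm

theorem neg_one_pow_mul_choose_neg_one (j : ℕ) : (-1) ^ j * Ring.choose (-1 : ℤ) j = 1 := by
  rw [Ring.choose_neg, show (1 + (j : ℤ) - 1) = (j : ℤ) by ring, Ring.choose_natCast,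
    Nat.choose_self, Int.negOnePow_def]
  rcases Nat.even_or_odd j with hj | hj <;> simp [hj.neg_one_pow, Units.smul_def]

/-- The Jacobi identity with `l = -1` and `m = 0`, where all binomial coefficients have absolute
value one. -/
theorem mode_normal_product (a b : V) (w : M) (n : ℤ) :
    mode M (mode V a (-1) b) n w =
      ∑ᶠ j : ℕ, (mode M a (-1 - j) (mode M b (n + j) w) +
        mode M b (n - 1 - j) (mode M a j w)) := by
  have h := jacobi_mode a b w (-1) 0 n
  rw [finsum_eq_single _ 0 (fun j hj => by
    rw [Ring.choose_zero_pos ℤ (Nat.pos_of_ne_zero hj), zero_smul])] at h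
  have hs : ((-1 : ℤ).negOnePow : ℤ) = -1 := by decide
  simp only [neg_one_pow_mul_choose_neg_one, hs, one_smul, neg_smul, sub_neg_eq_add] at h
  simp only [Ring.choose_zero_right, one_smul, Nat.cast_zero, add_zero, zero_add, sub_zero] at h
  rw [h]
  refine finsum_congr fun j => ?_
  rw [show (-1 + n - j : ℤ) = n - 1 - j by ring]

theorem mode_derived_product (a b : V) (w : M) (n : ℤ) :
    mode M (mode V a (-2) b) n w =
      ∑ᶠ j : ℕ, ((-1) ^ j * Ring.choose (-2 : ℤ) j) •
        (mode M a (-2 - j) (mode M b (n + j) w) - mode M b (n - 2 - j) (mode M a j w)) := by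
  have h := jacobi_mode a b w (-2) 0 n
  rw [finsum_eq_single _ 0 (fun j hj => by
    rw [Ring.choose_zero_pos ℤ (Nat.pos_of_ne_zero hj), zero_smul])] at h
  have hs : ((-2 : ℤ).negOnePow : ℤ) = 1 := by decide
  simp only [hs, one_smul, Ring.choose_zero_right, Nat.cast_zero, add_zero, zero_add,
    sub_zero] at h
  rw [h]
  refine finsum_congr fun j => ?_
  rw [show (-2 + n - j : ℤ) = n - 2 - j by ring]

theorem finsum_mem_submodule {ι : Type*} {f : ι → M} {Z : Submodule ℂ M} (h : ∀ i, f i ∈ Z) :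
    ∑ᶠ i, f i ∈ Z :=
  finsum_induction (· ∈ Z) Z.zero_mem (fun _ _ => Z.add_mem) h

/-! ### Letters and words -/

variable (V) in
/-- A homogeneous vector of `V` together with the degree by which the chosen mode of it shifts the
weights of a module. -/
structure Letter where
  wt : ℕ
  deg : ℤ
  vec : V
  mem : vec ∈ homogeneous V wt

variable (M) in
/-- The mode of `x.vec` that shifts weights by `x.deg`. -/
def Letter.op (x : Letter V) : Module.End ℂ M := mode M x.vec (x.wt - 1 - x.deg)

theorem Letter.op_mem (x : Letter V) {μ : ℂ} {w : M} (hw : w ∈ weightSpace V M μ) :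
    x.op M w ∈ weightSpace V M (μ + x.deg) := by
  have := mode_mem_weightSpace (M := M) x.mem hw (x.wt - 1 - x.deg)
  rwa [show (μ + ((x.wt : ℤ) : ℂ) - ((x.wt - 1 - x.deg : ℤ) : ℂ) - 1) = μ + x.deg by
    push_cast; ring] at this

/-- To show `(aᵢ b)_N u ∈ Z` it is enough to consider it as a letter. -/
theorem mode_mode_mem_of_letter [IsCFTType V] {a b : V} {k h i N : ℤ} {u : M}
    {Z : Submodule ℂ M} (ha : a ∈ homogeneous V k) (hb : b ∈ homogeneous V h)
    (hZ : ∀ z : Letter V, (z.wt : ℤ) = k + h - i - 1 → z.vec = mode V a i b →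
      z.deg = k + h - i - 2 - N → z.op M u ∈ Z) :
    mode M (mode V a i b) N u ∈ Z := by
  have hm := mode_mem_homogeneous ha hb i
  rcases lt_or_ge (k + h - i - 1) 0 with hneg | hpos
  · rw [IsCFTType.homogeneous_neg _ hneg, Submodule.mem_bot] at hm
    rw [hm, mode_zero, LinearMap.zero_apply]
    exact Z.zero_mem
  · obtain ⟨t, ht⟩ := Int.eq_ofNat_of_zero_le hpos
    rw [ht] at hm
    have := hZ ⟨t, k + h - i - 2 - N, mode V a i b, hm⟩ ht.symm rfl rfl
    rw [Letter.op] at this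
    dsimp only at this
    rwa [show ((t : ℤ) - 1 - (k + h - i - 2 - N)) = N by omega] at this

/-- The commutator formula involves only the products `aⱼ b` with `j ≥ 0`, of weight `wt a + wt b -
j - 1`. -/
theorem Letter.commutator_mem [IsCFTType V] (x y : Letter V) (u : M) {Z : Submodule ℂ M}
    (hZ : ∀ z : Letter V, z.wt < x.wt + y.wt → z.deg = x.deg + y.deg → z.op M u ∈ Z) :
    x.op M (y.op M u) - y.op M (x.op M u) ∈ Z := by
  rw [Letter.op, Letter.op, commutator_mode]
  refine finsum_mem_submodule fun j => Z.toAddSubgroup.zsmul_mem ?_ _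
  exact mode_mode_mem_of_letter x.mem y.mem fun z h1 _ h3 => hZ z (by omega) (by omega)

/-- The vector `a₋₂ b` has weight `wt a + wt b + 1`, while its modes are sums of products of a mode
of `a` and a mode of `b`. Such an expansion lowers the total weight by one. -/
theorem Letter.derived_mem {x y z : Letter V} (hz : z.vec = mode V x.vec (-2) y.vec)
    (hwt : z.wt = x.wt + y.wt + 1) (u : M) {Z : Submodule ℂ M}
    (hZ : ∀ p q : Letter V, p.wt + q.wt < z.wt → p.deg + q.deg = z.deg →
      p.op M (q.op M u) ∈ Z) :
    z.op M u ∈ Z := by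
  rw [Letter.op, hz, mode_derived_product]
  refine finsum_mem_submodule fun j => Z.toAddSubgroup.zsmul_mem (Z.sub_mem ?_ ?_) _
  · have := hZ ⟨x.wt, x.wt + 1 + j, x.vec, x.mem⟩
      ⟨y.wt, y.wt - 1 - (z.wt - 1 - z.deg + j), y.vec, y.mem⟩ (by simp; omega) (by simp; omega)
    convert this using 3 <;> first | omega | (congr 1; omega) | (simp only [Letter.op]; congr 1; omega)
  · have := hZ ⟨y.wt, y.wt - 1 - (z.wt - 1 - z.deg - 2 - j), y.vec, y.mem⟩
      ⟨x.wt, x.wt - 1 - j, x.vec, x.mem⟩ (by simp; omega) (by simp; omega)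
    convert this using 3 <;> first | omega | (congr 1; omega) | (simp only [Letter.op]; congr 1; omega)

/-- If all products `a[p] b[q] u` with `p + q = 2 d` other than `a[d] b[d] u` lie in `Z`, and all
relevant modes of `aᵢ b` do, then so does `a[d] b[d] u`. -/
theorem Letter.square_mem [IsCFTType V] (x y : Letter V) (hd : x.deg = y.deg) (u : M)
    {Z : Submodule ℂ M}
    (hlow : ∀ z : Letter V, z.wt < x.wt + y.wt → z.deg = x.deg + y.deg → z.op M u ∈ Z)
    (htop : ∀ z : Letter V, z.wt = x.wt + y.wt → z.deg = x.deg + y.deg → z.op M u ∈ Z)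
    (hoff : ∀ p q : Letter V, p.wt = x.wt → q.wt = y.wt → p.deg + q.deg = x.deg + y.deg →
      p.deg ≠ q.deg → p.op M (q.op M u) ∈ Z) :
    x.op M (y.op M u) ∈ Z := by
  set N : ℤ := x.wt + y.wt - 1 - (x.deg + y.deg) with hN
  have hprod : mode M (mode V x.vec (-1) y.vec) N u ∈ Z :=
    mode_mode_mem_of_letter x.mem y.mem fun z h1 _ h3 => htop z (by omega) (by omega)
  rw [mode_normal_product] at hprod
  have hp : ∀ p : ℤ, p ≠ x.deg →
      mode M x.vec (x.wt - 1 - p) (mode M y.vec (y.wt - 1 - (x.deg + y.deg - p)) u) ∈ Z :=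
    fun p hp => hoff ⟨x.wt, p, x.vec, x.mem⟩ ⟨y.wt, x.deg + y.deg - p, y.vec, y.mem⟩ rfl rfl
      (by simp) (by simp; omega)
  have hc : ∀ p : ℤ,
      mode M x.vec (x.wt - 1 - p) (mode M y.vec (y.wt - 1 - (x.deg + y.deg - p)) u) -
      mode M y.vec (y.wt - 1 - (x.deg + y.deg - p)) (mode M x.vec (x.wt - 1 - p) u) ∈ Z :=
    fun p => Letter.commutator_mem ⟨x.wt, p, x.vec, x.mem⟩
      ⟨y.wt, x.deg + y.deg - p, y.vec, y.mem⟩ u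
      fun z h1 h2 => hlow z h1 (by simpa using h2)
  set f : ℕ → M := fun j => mode M x.vec (-1 - j) (mode M y.vec (N + j) u) +
        mode M y.vec (N - 1 - j) (mode M x.vec j u) with hf
  -- A `finsum` with infinite support is zero by convention, so a single term can be isolated only
  -- once the support is known to be finite.
  have hfin : (Function.support f).Finite := by
    obtain ⟨A, hA⟩ := exists_mode_eq_zero x.vec u
    obtain ⟨B, hB⟩ := exists_mode_eq_zero y.vec u
    refine (Set.finite_lt_nat (A.toNat + (B - N).toNat)).subset fun j hj => ?_
    by_contra hlt
    simp only [Set.mem_ofPred_eq, not_lt] at hlt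
    exact hj (by simp only [hf]; rw [hA j (by omega), hB (N + j) (by omega)]; simp)
  have h1 : ∀ j : ℕ, (x.wt + j : ℤ) ≠ x.deg → mode M x.vec (-1 - j) (mode M y.vec (N + j) u) ∈ Z :=
    fun j hj => by
      convert hp (x.wt + j) hj using 3 <;> first | omega | (congr 1; omega)
  have h2 : ∀ j : ℕ, (x.wt - 1 - j : ℤ) ≠ x.deg →
      mode M y.vec (N - 1 - j) (mode M x.vec j u) ∈ Z := fun j hj => by
    have := Z.sub_mem (hp (x.wt - 1 - j) hj) (hc (x.wt - 1 - j))
    rw [sub_sub_cancel] at this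
    convert this using 3 <;> first | omega | (congr 1; omega)
  have hx : x.op M (y.op M u) =
      mode M x.vec (x.wt - 1 - x.deg) (mode M y.vec (y.wt - 1 - (x.deg + y.deg - x.deg)) u) := by
    rw [Letter.op, Letter.op, add_sub_cancel_left]
  have key : ∀ j₀ : ℕ, (∀ j, j ≠ j₀ → f j ∈ Z) → f j₀ ∈ Z := by
    intro j₀ hj
    rw [finsum_eq_sum_of_support_subset f (s := insert j₀ hfin.toFinset) (by
      intro j hj; simp; right; exact hj),
      ← Finset.add_sum_erase _ _ (Finset.mem_insert_self _ _)] at hprod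
    exact (Submodule.add_mem_iff_left Z (Z.sum_mem fun j hj' =>
      hj j (Finset.ne_of_mem_erase hj'))).mp hprod
  -- Each splitting of the total degree occurs exactly once in the normally ordered product: modes
  -- of `x.vec` of degree at least `x.wt` stand on the left, the others on the right. In the second
  -- case the wanted term appears in the opposite order and is corrected by a commutator.
  rcases le_or_gt (x.wt : ℤ) x.deg with hle | hlt
  · obtain ⟨j₀, hj₀⟩ := Int.le.dest hle
    have := key j₀ fun j hj => Z.add_mem (h1 j (by omega)) (h2 j (by omega))
    rw [hf] at this
    have := (Submodule.add_mem_iff_left Z (h2 j₀ (by omega))).mp this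
    rw [hx]
    convert this using 3 <;> first | omega | (congr 1; omega)
  · obtain ⟨j₀, hj₀⟩ := Int.le.dest (show x.deg ≤ x.wt - 1 by omega)
    have := key j₀ fun j hj => Z.add_mem (h1 j (by omega)) (h2 j (by omega))
    rw [hf] at this
    have := (Submodule.add_mem_iff_right Z (h1 j₀ (by omega))).mp this
    rw [hx]
    refine (Submodule.sub_mem_iff_left Z ?_).mp (hc x.deg)
    convert this using 3 <;> first | omega | (congr 1; omega)

variable (M) in
/-- The product of the modes in a word. -/
def wordOp (l : List (Letter V)) : Module.End ℂ M := (l.map (Letter.op M)).prod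

/-- The total weight of the vectors in a word. -/
def wordWt (l : List (Letter V)) : ℕ := (l.map Letter.wt).sum

/-- The total degree of a word. -/
def wordDeg (l : List (Letter V)) : ℤ := (l.map Letter.deg).sum

/-- The sum of the squares of the degrees in a word. -/
def wordSq (l : List (Letter V)) : ℤ := (l.map fun x => x.deg ^ 2).sum

@[simp] theorem wordOp_nil : wordOp M ([] : List (Letter V)) = 1 := rfl

@[simp] theorem wordOp_cons (x : Letter V) (l : List (Letter V)) :
    wordOp M (x :: l) = x.op M * wordOp M l := by simp [wordOp]

@[simp] theorem wordOp_append (l l' : List (Letter V)) :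
    wordOp M (l ++ l') = wordOp M l * wordOp M l' := by simp [wordOp]

@[simp] theorem wordWt_nil : wordWt ([] : List (Letter V)) = 0 := rfl

@[simp] theorem wordWt_cons (x : Letter V) (l : List (Letter V)) :
    wordWt (x :: l) = x.wt + wordWt l := by simp [wordWt]

@[simp] theorem wordWt_append (l l' : List (Letter V)) :
    wordWt (l ++ l') = wordWt l + wordWt l' := by simp [wordWt]

@[simp] theorem wordDeg_nil : wordDeg ([] : List (Letter V)) = 0 := rfl

@[simp] theorem wordDeg_cons (x : Letter V) (l : List (Letter V)) :
    wordDeg (x :: l) = x.deg + wordDeg l := by simp [wordDeg]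

@[simp] theorem wordDeg_append (l l' : List (Letter V)) :
    wordDeg (l ++ l') = wordDeg l + wordDeg l' := by simp [wordDeg]

@[simp] theorem wordSq_cons (x : Letter V) (l : List (Letter V)) :
    wordSq (x :: l) = x.deg ^ 2 + wordSq l := by simp [wordSq]

@[simp] theorem wordSq_nil : wordSq ([] : List (Letter V)) = 0 := rfl

@[simp] theorem wordSq_append (l l' : List (Letter V)) :
    wordSq (l ++ l') = wordSq l + wordSq l' := by simp [wordSq]

theorem _root_.List.Perm.wordWt_eq {l l' : List (Letter V)} (h : l.Perm l') :
    wordWt l = wordWt l' := (h.map _).sum_eq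

theorem _root_.List.Perm.wordDeg_eq {l l' : List (Letter V)} (h : l.Perm l') :
    wordDeg l = wordDeg l' := (h.map _).sum_eq

theorem _root_.List.Perm.wordSq_eq {l l' : List (Letter V)} (h : l.Perm l') :
    wordSq l = wordSq l' := (h.map _).sum_eq

theorem wordDeg_nonneg {l : List (Letter V)} (h : ∀ x ∈ l, 0 ≤ x.deg) : 0 ≤ wordDeg l :=
  List.sum_nonneg (by simpa using h)

/-- Since the total degree stays fixed while equal degrees are separated, this upper bound makes the
induction on the sum of squares terminate. -/
theorem wordSq_le {l : List (Letter V)} (h : ∀ x ∈ l, 0 ≤ x.deg) : wordSq l ≤ wordDeg l ^ 2 := by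
  induction l with
  | nil => simp
  | cons x l ih =>
    have h1 := ih fun y hy => h y (List.mem_cons_of_mem _ hy)
    have h2 := wordDeg_nonneg fun y hy => h y (List.mem_cons_of_mem x hy)
    have h3 := h x List.mem_cons_self
    simp only [wordSq_cons, wordDeg_cons]
    nlinarith [mul_nonneg h2 h3]

theorem wordOp_mem {l : List (Letter V)} {μ : ℂ} {w : M} (hw : w ∈ weightSpace V M μ) :
    wordOp M l w ∈ weightSpace V M (μ + wordDeg l) := by
  induction l with
  | nil => simpa using hw
  | cons x l ih =>
    have := x.op_mem ih
    rw [wordOp_cons, Module.End.mul_apply, wordDeg_cons]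
    rwa [show μ + ((x.deg + wordDeg l : ℤ) : ℂ) = μ + wordDeg l + x.deg by push_cast; ring]

/-- The span of all words of total weight less than `s` and total degree `D`, applied to `W`. -/
def wordSpan (W : Submodule ℂ M) (s : ℕ) (D : ℤ) : Submodule ℂ M :=
  Submodule.span ℂ {m | ∃ l : List (Letter V), ∃ w ∈ W,
    wordWt l < s ∧ wordDeg l = D ∧ m = wordOp M l w}

theorem wordOp_mem_wordSpan {W : Submodule ℂ M} {l : List (Letter V)} {s : ℕ} {D : ℤ} {w : M}
    (hw : w ∈ W) (hs : wordWt l < s) (hD : wordDeg l = D) :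
    wordOp M l w ∈ wordSpan (V := V) W s D :=
  Submodule.subset_span ⟨l, w, hw, hs, hD, rfl⟩

theorem wordSpan_mono {W : Submodule ℂ M} {s t : ℕ} (h : s ≤ t) (D : ℤ) :
    wordSpan (V := V) W s D ≤ wordSpan (V := V) W t D := by
  refine Submodule.span_mono ?_
  rintro m ⟨l, w, hw, hs, hD, rfl⟩
  exact ⟨l, w, hw, hs.trans_le h, hD, rfl⟩

theorem wordOp_apply_mem_wordSpan {W : Submodule ℂ M} {s : ℕ} {D : ℤ} (l : List (Letter V))
    {m : M} (hm : m ∈ wordSpan (V := V) W s D) :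
    wordOp M l m ∈ wordSpan (V := V) W (wordWt l + s) (wordDeg l + D) := by
  suffices wordSpan (V := V) W s D ≤
    (wordSpan (V := V) W (wordWt l + s) (wordDeg l + D)).comap (wordOp M l) from this hm
  refine Submodule.span_le.mpr ?_
  rintro m ⟨l', w, hw, hs, hD, rfl⟩
  have : wordOp M (l ++ l') w ∈ wordSpan (V := V) W (wordWt l + s) (wordDeg l + D) :=
    wordOp_mem_wordSpan hw (by simpa using hs) (by simp [hD])
  simpa using this

/-- Permuting the letters of a word changes it by words of lower weight. -/
theorem wordOp_sub_mem_of_perm [IsCFTType V] {W : Submodule ℂ M} {l l' : List (Letter V)}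
    (h : l.Perm l') {w : M} (hw : w ∈ W) :
    wordOp M l w - wordOp M l' w ∈ wordSpan (V := V) W (wordWt l) (wordDeg l) := by
  induction h with
  | nil => simp
  | @cons x l l' h ih =>
    have := wordOp_apply_mem_wordSpan [x] ih
    simpa using this
  | swap x y l =>
    simp only [wordOp_cons, Module.End.mul_apply]
    refine Letter.commutator_mem y x _ fun z h1 h2 => ?_
    have := wordOp_mem_wordSpan (M := M) (l := z :: l) (s := y.wt + (x.wt + wordWt l))
      (D := y.deg + (x.deg + wordDeg l)) hw
      (by simp; omega) (by simp; omega)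
    simpa using this
  | trans h1 h2 ih1 ih2 =>
    rw [← h1.wordWt_eq, ← h1.wordDeg_eq] at ih2
    simpa using Submodule.add_mem _ ih1 ih2

/-- Words in vectors of weight at most `K` with distinct nonnegative degrees. -/
def IsReducedWord (K : ℕ) (l : List (Letter V)) : Prop :=
  (∀ x ∈ l, x.wt ≤ K ∧ 0 ≤ x.deg) ∧ (l.map Letter.deg).Nodup

/-- The span of the reduced words of total degree `D`, applied to `W`. -/
def reducedSpan (V : Type u) [AddCommGroup V] [Module ℂ V] [VertexOperatorAlgebra V]
    [VOAModule V M] (W : Submodule ℂ M) (K : ℕ) (D : ℤ) : Submodule ℂ M :=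
  Submodule.span ℂ {m | ∃ l : List (Letter V), ∃ w ∈ W,
    IsReducedWord K l ∧ wordDeg l = D ∧ m = wordOp M l w}

variable (V) in
/-- The part of `C₂(V)` of weight `k`. -/
def derivedSpan (k : ℕ) : Submodule ℂ V :=
  Submodule.span ℂ {c | ∃ i j : ℕ, i + j + 1 = k ∧ ∃ x ∈ homogeneous V i, ∃ y ∈ homogeneous V j,
    c = mode V x (-2) y}

theorem derivedSpan_le (k : ℕ) : derivedSpan V k ≤ homogeneous V k := by
  refine Submodule.span_le.mpr ?_
  rintro c ⟨i, j, hk, x, hx, y, hy, rfl⟩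
  have := mode_mem_homogeneous hx hy (-2)
  rwa [show (i + j - -2 - 1 : ℤ) = k by omega] at this

theorem Letter.op_mem_of_mem_derivedSpan {z : Letter V} (hz : z.vec ∈ derivedSpan V z.wt) (u : M)
    {Z : Submodule ℂ M}
    (hZ : ∀ p q : Letter V, p.wt + q.wt < z.wt → p.deg + q.deg = z.deg →
      p.op M (q.op M u) ∈ Z) :
    z.op M u ∈ Z := by
  suffices derivedSpan V z.wt ≤ Z.comap (modeFlip M (z.wt - 1 - z.deg) u) from this hz
  refine Submodule.span_le.mpr ?_
  rintro c ⟨i, j, hk, x, hx, y, hy, rfl⟩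
  have hm : mode V x (-2) y ∈ homogeneous V z.wt :=
    derivedSpan_le _ (Submodule.subset_span ⟨i, j, hk, x, hx, y, hy, rfl⟩)
  -- The degrees `0` are placeholders; only the vectors and weights of these two letters matter.
  exact Letter.derived_mem (x := ⟨i, 0, x, hx⟩) (y := ⟨j, 0, y, hy⟩)
    (z := ⟨z.wt, z.deg, mode V x (-2) y, hm⟩) rfl hk.symm u hZ

theorem exists_perm_of_not_nodup {l : List (Letter V)} (h : ¬ (l.map Letter.deg).Nodup) :
    ∃ (l' : List (Letter V)) (x y : Letter V), l.Perm (l' ++ [x, y]) ∧ x.deg = y.deg := by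
  induction l with
  | nil => simp at h
  | cons z l ih =>
    rw [List.map_cons, List.nodup_cons, not_and_or, not_not] at h
    rcases h with h | h
    · obtain ⟨y, hy, hyz⟩ := List.mem_map.mp h
      obtain ⟨s, t, rfl⟩ := List.append_of_mem hy
      refine ⟨s ++ t, z, y, ?_, hyz.symm⟩
      refine ((List.perm_middle).cons z).trans ?_
      exact List.perm_append_comm (l₁ := [z, y]) (l₂ := s ++ t)
    · obtain ⟨l', x, y, hp, hd⟩ := ih h
      exact ⟨z :: l', x, y, hp.cons z, hd⟩

/-! ### Reduction to words with distinct degrees -/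

section Reduction

variable [IsCFTType V] {W : Submodule ℂ M} {K : ℕ}

/-- By induction on the total weight, then on the length, then on the distance of the sum of squares
of the degrees from its maximum, every word is a combination of reduced words. -/
theorem wordOp_mem_reducedSpan
    (hW : ∀ x : Letter V, x.deg < 0 → ∀ w ∈ W, x.op M w = 0)
    (hK : ∀ k, K < k → homogeneous V k ≤ derivedSpan V k) {s : ℕ}
    (ih : ∀ D, wordSpan (V := V) W s D ≤ reducedSpan V W K D)
    {w : M} (hw : w ∈ W) (l : List (Letter V)) (hl : wordWt l ≤ s) :
    wordOp M l w ∈ reducedSpan V W K (wordDeg l) := by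
  have hperm : ∀ {l l' : List (Letter V)}, l.Perm l' → wordWt l ≤ s →
      wordOp M l' w ∈ reducedSpan V W K (wordDeg l') →
      wordOp M l w ∈ reducedSpan V W K (wordDeg l) := by
    intro l l' h hl hm
    rw [← h.wordDeg_eq] at hm
    refine (Submodule.sub_mem_iff_left _ hm).mp (ih _ (wordSpan_mono hl _ ?_))
    exact wordOp_sub_mem_of_perm h hw
  -- A letter of negative degree is moved to the right end, where it annihilates `W`; the
  -- commutators are words of lower weight.
  have hneg : ∀ l : List (Letter V), wordWt l ≤ s → (∃ x ∈ l, x.deg < 0) →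
      wordOp M l w ∈ reducedSpan V W K (wordDeg l) := by
    rintro l hl ⟨x, hx, hd⟩
    obtain ⟨a, b, rfl⟩ := List.append_of_mem hx
    refine hperm (l' := (a ++ b) ++ [x])
      (List.perm_middle.trans (List.perm_append_comm (l₁ := [x]))) hl ?_
    rw [wordOp_append, Module.End.mul_apply, wordOp_cons, wordOp_nil, mul_one, hW x hd w hw,
      map_zero]
    exact Submodule.zero_mem _
  induction hn : l.length using Nat.strong_induction_on generalizing l with
  | _ n ihn =>
  induction hm : (wordDeg l ^ 2 - wordSq l).toNat using Nat.strong_induction_on generalizing l with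
  | _ m ihm =>
  by_cases h1 : ∃ x ∈ l, x.deg < 0
  · exact hneg l hl h1
  push Not at h1
  by_cases h2 : ∃ z ∈ l, K < z.wt
  · obtain ⟨z, hz, hlt⟩ := h2
    obtain ⟨a, b, rfl⟩ := List.append_of_mem hz
    refine hperm (l' := z :: (a ++ b)) List.perm_middle hl ?_
    rw [wordOp_cons, Module.End.mul_apply]
    refine Letter.op_mem_of_mem_derivedSpan (hK _ hlt z.mem) _ fun p q hpq hd => ih _ ?_
    have := wordOp_mem_wordSpan (M := M) (l := p :: q :: (a ++ b)) (s := s)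
      (D := wordDeg (z :: (a ++ b))) hw (by simp at hl ⊢; omega) (by simp; omega)
    simpa using this
  push Not at h2
  by_cases h3 : (l.map Letter.deg).Nodup
  · exact Submodule.subset_span ⟨l, w, hw, ⟨fun x hx => ⟨h2 x hx, h1 x hx⟩, h3⟩, rfl, rfl⟩
  obtain ⟨a, x, y, hp, hd⟩ := exists_perm_of_not_nodup h3
  have hwt := hp.wordWt_eq
  have hdeg := hp.wordDeg_eq
  have hsq := hp.wordSq_eq
  have hlen := hp.length_eq
  have hsqle := wordSq_le h1
  simp only [wordWt_append, wordWt_cons, wordWt_nil, wordDeg_append, wordDeg_cons, wordDeg_nil,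
    wordSq_append, wordSq_cons, wordSq_nil, List.length_append, List.length_cons,
    List.length_nil] at hwt hdeg hsq hlen
  refine hperm hp hl ?_
  rw [← hp.wordDeg_eq, wordOp_append, Module.End.mul_apply, wordOp_cons, wordOp_cons, wordOp_nil,
    mul_one, Module.End.mul_apply]
  change _ ∈ (reducedSpan V W K (wordDeg l)).comap (wordOp M a)
  -- The equal degrees now stand next to `w`, and the three goals match the three inductions:
  -- commutator terms have lower total weight, a mode of the product gives a shorter word, and the
  -- other splittings have a larger sum of squares.
  refine Letter.square_mem x y hd w ?_ ?_ ?_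
  · intro z hz hzd
    have := wordOp_mem_wordSpan (M := M) (l := a ++ [z]) (s := s)
      (D := wordDeg l) hw (by simp; omega) (by simp; omega)
    simpa using ih _ this
  · intro z hz hzd
    have := ihn (a ++ [z]).length (by simp; omega) (a ++ [z]) (by simp; omega) rfl
    rw [show wordDeg (a ++ [z]) = wordDeg l by simp; omega] at this
    simpa using this
  · intro p q hpw hqw hpq hne
    have e : wordDeg (a ++ [p, q]) = wordDeg l := by simp; omega
    have hwt' : wordWt (a ++ [p, q]) ≤ s := by simp; omega
    suffices wordOp M (a ++ [p, q]) w ∈ reducedSpan V W K (wordDeg (a ++ [p, q])) by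
      rw [e] at this
      simpa using this
    by_cases h4 : ∃ x ∈ a ++ [p, q], x.deg < 0
    · exact hneg _ hwt' h4
    push Not at h4
    refine ihm _ ?_ (a ++ [p, q]) hwt' (by simp; omega) rfl
    have h5 := wordSq_le h4
    -- If `p + q = 2d` then `p² + q² = 2d² + (p - q)²/2`.
    have h6 : wordSq l < wordSq (a ++ [p, q]) := by
      rw [hsq]
      simp only [wordSq_append, wordSq_cons, wordSq_nil]
      have : 0 < (p.deg - q.deg) ^ 2 := by
        have := sub_ne_zero.mpr hne
        positivity
      have hp' : p.deg = 2 * y.deg - q.deg := by omega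
      rw [hp'] at this ⊢
      rw [hd]
      nlinarith
    rw [e] at h5 ⊢
    omega

theorem wordSpan_le_reducedSpan
    (hW : ∀ x : Letter V, x.deg < 0 → ∀ w ∈ W, x.op M w = 0)
    (hK : ∀ k, K < k → homogeneous V k ≤ derivedSpan V k) (s : ℕ) (D : ℤ) :
    wordSpan (V := V) W s D ≤ reducedSpan V W K D := by
  induction s generalizing D with
  | zero =>
    refine Submodule.span_le.mpr ?_
    rintro m ⟨l, w, hw, hs, hD, rfl⟩
    omega
  | succ s ih =>
    refine Submodule.span_le.mpr ?_
    rintro m ⟨l, w, hw, hs, rfl, rfl⟩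
    exact wordOp_mem_reducedSpan hW hK ih hw l (by omega)

end Reduction

/-! ### Consequences of `C₂`-cofiniteness -/

variable (V) in
theorem isInternal_homogeneous : DirectSum.IsInternal fun n : ℤ => homogeneous V n := graded

variable (V) in
theorem iSup_homogeneous [IsCFTType V] : ⨆ k : ℕ, homogeneous V k = ⊤ := by
  refine top_le_iff.mp ((isInternal_homogeneous V).submodule_iSup_eq_top ▸ iSup_le fun n => ?_)
  rcases lt_or_ge n 0 with hn | hn
  · rw [IsCFTType.homogeneous_neg n hn]
    exact bot_le
  · obtain ⟨k, rfl⟩ := Int.eq_ofNat_of_zero_le hn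
    exact le_iSup (fun k : ℕ => homogeneous V k) k

variable (V) in
theorem iSupIndep_homogeneous : iSupIndep fun k : ℕ => homogeneous V k :=
  (isInternal_homogeneous V).submodule_iSupIndep.comp Nat.cast_injective

/-- A property of vectors that is closed under addition holds for all vectors if it holds for the
homogeneous ones. -/
theorem homogeneous_induction [IsCFTType V] {Z : Submodule ℂ V}
    (h : ∀ k : ℕ, ∀ a ∈ homogeneous V k, a ∈ Z) (a : V) : a ∈ Z :=
  (top_le_iff.mp (iSup_homogeneous V ▸ iSup_le h) : Z = ⊤) ▸ Submodule.mem_top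

theorem C₂_le_iSup_derivedSpan [IsCFTType V] : C₂ V ≤ ⨆ k, derivedSpan V k := by
  refine Submodule.span_le.mpr ?_
  rintro _ ⟨a, b, rfl⟩
  change a ∈ (⨆ k, derivedSpan V k).comap (modeFlip V (-2) b)
  refine homogeneous_induction (fun i x hx => ?_) a
  change b ∈ (⨆ k, derivedSpan V k).comap (mode V x (-2))
  refine homogeneous_induction (fun j y hy => ?_) b
  exact Submodule.mem_iSup_of_mem (i + j + 1)
    (Submodule.subset_span ⟨i, j, rfl, x, hx, y, hy, rfl⟩)

variable (V) in
theorem exists_homogeneous_le_derivedSpan [IsCFTType V] [Module.Finite ℂ (V ⧸ C₂ V)] :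
    ∃ K : ℕ, ∀ k, K < k → homogeneous V k ≤ derivedSpan V k := by
  classical
  have hc : IsCompactElement (⊤ : Submodule ℂ (V ⧸ C₂ V)) :=
    (Submodule.fg_iff_compact _).mp Module.Finite.fg_top
  have htop : (⊤ : Submodule ℂ (V ⧸ C₂ V)) ≤ ⨆ k : ℕ, (homogeneous V k).map (C₂ V).mkQ := by
    rw [← Submodule.map_iSup, iSup_homogeneous, Submodule.map_top, Submodule.range_mkQ]
  obtain ⟨t, ht⟩ := CompleteLattice.IsCompactElement.exists_finset_of_le_iSup _ hc _ htop
  -- The finitely many weights in `t` already span the quotient by `C₂ V`. Together with the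
  -- homogeneous parts of `C₂ V` they span `V`, and independence of the weight spaces then gives
  -- equality in each weight.
  let D : ℕ → Submodule ℂ V := fun k => if k ∈ t then homogeneous V k else derivedSpan V k
  have hD : ∀ k, derivedSpan V k ≤ D k := fun k => by
    by_cases hk : k ∈ t
    · simpa [D, hk] using derivedSpan_le k
    · simp [D, hk]
  have hD' : ∀ k, D k ≤ homogeneous V k := fun k => by
    by_cases hk : k ∈ t
    · simp [D, hk]
    · simpa [D, hk] using derivedSpan_le k
  have hsup : ⨆ k, D k = ⊤ := by
    have h1 : C₂ V ≤ ⨆ k, D k := C₂_le_iSup_derivedSpan.trans (iSup_mono hD)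
    have h2 : (⊤ : Submodule ℂ (V ⧸ C₂ V)) ≤ (⨆ k, D k).map (C₂ V).mkQ := by
      refine ht.trans (iSup₂_le fun k hk => Submodule.map_mono ?_)
      have : homogeneous V k = D k := by simp [D, hk]
      exact this ▸ le_iSup D k
    have h3 := Submodule.comap_mono (f := (C₂ V).mkQ) h2
    rw [Submodule.comap_top, Submodule.comap_map_mkQ, sup_eq_right.mpr h1] at h3
    exact top_le_iff.mp h3
  refine ⟨t.sup id, fun k hk => ?_⟩
  have hkt : k ∉ t := fun h => absurd (Finset.le_sup (f := id) h) (by simpa using hk)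
  have := (iSupIndep_homogeneous V).eq_of_le_of_iSup_eq_top hD' hsup k
  simpa [D, hkt] using this.ge

/-! ### Weight spaces of an irreducible module -/

theorem reducedSpan_le_weightSpace {μ : ℂ} (K : ℕ) (D : ℤ) :
    reducedSpan V (weightSpace V M μ) K D ≤ weightSpace V M (μ + D) := by
  refine Submodule.span_le.mpr ?_
  rintro _ ⟨l, w, hw, -, rfl, rfl⟩
  exact wordOp_mem hw

theorem reducedSpan_of_neg (W : Submodule ℂ M) (K : ℕ) {D : ℤ} (hD : D < 0) :
    reducedSpan V W K D = ⊥ := by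
  refine le_bot_iff.mp (Submodule.span_le.mpr ?_)
  rintro _ ⟨l, w, hw, hl, rfl, rfl⟩
  exact absurd (wordDeg_nonneg fun x hx => (hl.1 x hx).2) (by omega)

theorem exists_lowest_weight [IsOrdinaryModule V M] [Nontrivial M] :
    ∃ μ : ℂ, weightSpace V M μ ≠ ⊥ ∧ ∀ n : ℤ, n < 0 → weightSpace V M (μ + n) = ⊥ := by
  obtain ⟨μ, hμ⟩ : ∃ μ, weightSpace V M μ ≠ ⊥ := by
    by_contra! h
    have := (IsOrdinaryModule.internal (V := V) (M := M)).submodule_iSup_eq_top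
    rw [iSup_congr h, iSup_bot] at this
    exact bot_ne_top this
  obtain ⟨N, hN⟩ := IsOrdinaryModule.bounded_below (V := V) (M := M) μ
  obtain ⟨n, hn, hmin⟩ := Int.exists_least_of_bdd (P := fun n => weightSpace V M (μ + n) ≠ ⊥)
    ⟨N, fun z hz => not_lt.mp fun h => hz (hN z h)⟩ ⟨0, by simpa using hμ⟩
  refine ⟨μ + n, hn, fun m hm => ?_⟩
  by_contra h
  have := hmin (n + m) (by push_cast; rwa [← add_assoc])
  omega

/-- An irreducible module is spanned by the words applied to any nonzero subspace. -/
theorem iSup_wordSpan [IsCFTType V] (hM : IsIrreducibleModule V M) {W : Submodule ℂ M}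
    (hW : W ≠ ⊥) : ⨆ (D : ℤ) (s : ℕ), wordSpan (V := V) W s D = ⊤ := by
  set T := ⨆ (D : ℤ) (s : ℕ), wordSpan (V := V) W s D with hT
  have hmem : ∀ (l : List (Letter V)), ∀ w ∈ W, wordOp M l w ∈ T := fun l w hw =>
    Submodule.mem_iSup_of_mem (wordDeg l) (Submodule.mem_iSup_of_mem (wordWt l + 1)
      (wordOp_mem_wordSpan hw (by omega) rfl))
  have hsub : IsVSubmodule V T := by
    intro a n m hm
    change a ∈ T.comap (modeFlip M n m)
    refine homogeneous_induction (fun k a ha => ?_) a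
    change m ∈ T.comap (mode M a n)
    suffices T ≤ T.comap (mode M a n) from this hm
    refine iSup₂_le fun D s => Submodule.span_le.mpr ?_
    rintro _ ⟨l, w, hw, -, -, rfl⟩
    have := hmem (⟨k, k - 1 - n, a, ha⟩ :: l) w hw
    simpa [Letter.op] using this
  refine (hM.2 T hsub).resolve_left fun h => hW (le_bot_iff.mp fun w hw => ?_)
  exact h ▸ hmem [] w hw

/-- The weight spaces of an irreducible module are spanned by reduced words. -/
theorem exists_weightSpace_eq_reducedSpan [IsCFTType V] [Module.Finite ℂ (V ⧸ C₂ V)]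
    [IsOrdinaryModule V M] (hM : IsIrreducibleModule V M) :
    ∃ (K : ℕ) (μ : ℂ),
      (∀ n : ℕ, weightSpace V M (μ + n) = reducedSpan V (weightSpace V M μ) K n) ∧
      ∀ ν, (∀ n : ℕ, μ + n ≠ ν) → weightSpace V M ν = ⊥ := by
  have := hM.1
  obtain ⟨μ, hμ, hlow⟩ := exists_lowest_weight (V := V) (M := M)
  obtain ⟨K, hK⟩ := exists_homogeneous_le_derivedSpan V
  have hW : ∀ x : Letter V, x.deg < 0 → ∀ w ∈ weightSpace V M μ, x.op M w = 0 := by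
    intro x hx w hw
    have := x.op_mem hw
    rwa [hlow _ hx, Submodule.mem_bot] at this
  -- `B ν` is the span of reduced words if `ν ∈ μ + ℕ` and zero otherwise. These subspaces lie in
  -- the weight spaces and together span `M`, so they equal the weight spaces; both conclusions
  -- follow.
  let B : ℂ → Submodule ℂ M := fun ν =>
    ⨆ (n : ℕ) (_ : μ + n = ν), reducedSpan V (weightSpace V M μ) K n
  have hB : ∀ ν, B ν ≤ weightSpace V M ν := by
    refine fun ν => iSup₂_le fun n hn => ?_
    have := reducedSpan_le_weightSpace (V := V) (M := M) (μ := μ) K n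
    rwa [Int.cast_natCast, hn] at this
  have hBtop : ⨆ ν, B ν = ⊤ := by
    rw [← top_le_iff, ← iSup_wordSpan hM hμ]
    refine iSup₂_le fun D s => (wordSpan_le_reducedSpan hW hK s D).trans ?_
    rcases lt_or_ge D 0 with hD | hD
    · exact (reducedSpan_of_neg _ _ hD).le.trans bot_le
    · obtain ⟨n, rfl⟩ := Int.eq_ofNat_of_zero_le hD
      exact le_iSup_of_le (μ + n) (le_iSup₂_of_le n rfl le_rfl)
  have key := (IsOrdinaryModule.internal (V := V) (M := M)).submodule_iSupIndep.eq_of_le_of_iSup_eq_top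
    hB hBtop
  refine ⟨K, μ, fun n => ?_, fun ν hν => ?_⟩
  · rw [← key]
    refine le_antisymm (iSup₂_le fun m hm => ?_) (le_iSup₂_of_le n rfl le_rfl)
    rw [show m = n by exact_mod_cast add_left_cancel hm]
  · rw [← key, ← le_bot_iff]
    exact iSup₂_le fun n hn => absurd hn (hν n)

end VOA

/-! ### Traces and spanning families -/

section Trace

variable {E : Type*} [AddCommGroup E] [Module ℂ E] {ι : Type*}

/-- `f` has norm at most `R` with respect to the seminorm on functionals given by their largest
absolute value on the family `x`. -/
def DualBound (x : ι → E) (f : Module.End ℂ E) (R : ℝ) : Prop :=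
  ∀ (φ : Module.Dual ℂ E) (B : ℝ), (∀ i, ‖φ (x i)‖ ≤ B) → ∀ i, ‖φ (f (x i))‖ ≤ R * B

theorem DualBound.pow {x : ι → E} {f : Module.End ℂ E} {R : ℝ} (h : DualBound x f R) (k : ℕ) :
    DualBound x (f ^ k) (R ^ k) := by
  induction k with
  | zero => intro φ B hB i; simpa using hB i
  | succ k ih =>
    intro φ B hB i
    have := h (φ ∘ₗ f ^ k) (R ^ k * B) (fun i => ih φ B hB i) i
    rw [pow_succ, pow_succ', mul_assoc]
    exact this

theorem DualBound.add {x : ι → E} {f g : Module.End ℂ E} {R S : ℝ} (hf : DualBound x f R)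
    (hg : DualBound x g S) : DualBound x (f + g) (R + S) := by
  intro φ B hB i
  rw [LinearMap.add_apply, map_add, add_mul]
  exact (norm_add_le _ _).trans (add_le_add (hf φ B hB i) (hg φ B hB i))

theorem DualBound.smul {x : ι → E} {f : Module.End ℂ E} {R : ℝ} (hf : DualBound x f R) (c : ℂ) :
    DualBound x (c • f) (‖c‖ * R) := by
  intro φ B hB i
  rw [LinearMap.smul_apply, map_smul, norm_smul, mul_assoc]
  exact mul_le_mul_of_nonneg_left (hf φ B hB i) (norm_nonneg c)

theorem DualBound.zero {x : ι → E} : DualBound x (0 : Module.End ℂ E) 0 := by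
  intro φ B hB i
  simp

theorem DualBound.mono {x : ι → E} {f : Module.End ℂ E} {R S : ℝ} (hf : DualBound x f R)
    (hRS : R ≤ S) : DualBound x f S := fun φ B hB i =>
  (hf φ B hB i).trans (mul_le_mul_of_nonneg_right hRS ((norm_nonneg _).trans (hB i)))

theorem exists_dualBound {κ : Type*} [Fintype κ] (b : Module.Basis κ ℂ E) (f : Module.End ℂ E) :
    ∃ R, 0 ≤ R ∧ DualBound b f R := by
  refine ⟨∑ i, ∑ j, ‖b.repr (f (b i)) j‖, by positivity, fun φ B hB i => ?_⟩
  have hB0 : 0 ≤ B := (norm_nonneg _).trans (hB i)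
  calc ‖φ (f (b i))‖ = ‖∑ j, b.repr (f (b i)) j * φ (b j)‖ := by
        conv_lhs => rw [← b.sum_repr (f (b i)), map_sum]
        simp only [map_smul, smul_eq_mul]
    _ ≤ ∑ j, ‖b.repr (f (b i)) j‖ * B := by
        refine norm_sum_le_of_le _ fun j _ => ?_
        rw [norm_mul]
        exact mul_le_mul_of_nonneg_left (hB j) (norm_nonneg _)
    _ = (∑ j, ‖b.repr (f (b i)) j‖) * B := by rw [Finset.sum_mul]
    _ ≤ _ := by
        refine mul_le_mul_of_nonneg_right ?_ hB0
        exact Finset.single_le_sum (f := fun i => ∑ j, ‖b.repr (f (b i)) j‖)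
          (fun i _ => by positivity) (Finset.mem_univ i)

variable [Module.Finite ℂ E] [Finite ι]

/-- The family only spans, so matrix entries are not available. Instead a functional `φ` with `φ ∘ f
= α φ` is evaluated at the member of the family where its absolute value is largest. -/
theorem DualBound.norm_eigenvalue_le {x : ι → E} (hx : Submodule.span ℂ (Set.range x) = ⊤)
    {f : Module.End ℂ E} {R : ℝ} (h : DualBound x f R) {α : ℂ} (hα : f.HasEigenvalue α) :
    ‖α‖ ≤ R := by
  -- In finite dimension `f - α` is not surjective, so a nonzero functional vanishes on its range;
  -- it is an eigenvector of the transpose.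
  have hne : LinearMap.range (f - algebraMap ℂ _ α) < ⊤ := by
    rw [lt_top_iff_ne_top]
    intro htop
    have hinj := LinearMap.injective_iff_surjective.mpr (LinearMap.range_eq_top.mp htop)
    obtain ⟨e, he⟩ := hα.exists_hasEigenvector
    refine he.2 (hinj ?_)
    simp [he.apply_eq_smul, Module.algebraMap_end_apply]
  obtain ⟨φ, hφ0, hφ⟩ := Submodule.exists_le_ker_of_lt_top _ hne
  have hφf : ∀ e, φ (f e) = α * φ e := fun e => by
    have : φ ((f - algebraMap ℂ _ α) e) = 0 := hφ ⟨e, rfl⟩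
    simpa [Module.algebraMap_end_apply, sub_eq_zero] using this
  have hex : ∃ i, φ (x i) ≠ 0 := by
    by_contra! hz
    exact hφ0 (LinearMap.ext_on_range hx fun i => by simpa using hz i)
  obtain ⟨i₁, hi₁⟩ := hex
  have : Nonempty ι := ⟨i₁⟩
  obtain ⟨i₀, hi₀⟩ := Finite.exists_max fun i => ‖φ (x i)‖
  have hpos : 0 < ‖φ (x i₀)‖ := (norm_pos_iff.mpr hi₁).trans_le (hi₀ i₁)
  have := h φ _ hi₀ i₀
  rw [hφf, norm_mul] at this
  exact le_of_mul_le_mul_right this hpos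

/-- The trace is the sum of the roots of the characteristic polynomial. The factor is thus the
dimension, not the size of the spanning family. -/
theorem DualBound.norm_trace_le {x : ι → E} (hx : Submodule.span ℂ (Set.range x) = ⊤)
    {f : Module.End ℂ E} {R : ℝ} (hR : 0 ≤ R) (h : DualBound x f R) :
    ‖LinearMap.trace ℂ E f‖ ≤ Module.finrank ℂ E * R := by
  rw [Module.End.trace_eq_sum_roots_charpoly_of_splits (IsAlgClosed.splits f.charpoly)]
  have h1 : ∀ s : Multiset ℂ, (∀ α ∈ s, ‖α‖ ≤ R) → ‖s.sum‖ ≤ s.card * R := by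
    intro s
    induction s using Multiset.induction with
    | empty => simp
    | cons a s ih =>
      intro hs
      rw [Multiset.sum_cons, Multiset.card_cons]
      push_cast
      have := ih fun α hα => hs α (Multiset.mem_cons_of_mem hα)
      have := hs a (Multiset.mem_cons_self a s)
      linarith [norm_add_le a s.sum]
  refine (h1 _ fun α hα => h.norm_eigenvalue_le hx ?_).trans ?_
  · exact (Module.End.hasEigenvalue_iff_isRoot_charpoly f α).mpr (Polynomial.isRoot_of_mem_roots hα)
  · refine mul_le_mul_of_nonneg_right ?_ hR
    rw [← LinearMap.charpoly_natDegree f]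
    exact_mod_cast Polynomial.card_roots' _

end Trace

namespace VOA

/-! ### Traces of exponentials -/

section Exponential

variable {E : Type v} [AddCommGroup E] [Module ℂ E] [Module.Finite ℂ E]

attribute [local instance] Matrix.linftyOpNormedRing Matrix.linftyOpNormedAlgebra

theorem trace_expEnd (A : Module.End ℂ E) : LinearMap.trace ℂ E (expEnd A) =
    (NormedSpace.exp (LinearMap.toMatrix (Module.finBasis ℂ E) (Module.finBasis ℂ E) A)).trace := by
  rw [expEnd, LinearMap.trace_eq_matrix_trace ℂ (Module.finBasis ℂ E), LinearMap.toMatrix_toLin]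

theorem hasSum_trace_expEnd (A : Module.End ℂ E) :
    HasSum (fun k : ℕ => (k.factorial : ℂ)⁻¹ * LinearMap.trace ℂ E (A ^ k))
      (LinearMap.trace ℂ E (expEnd A)) := by
  rw [trace_expEnd]
  have h := NormedSpace.exp_series_hasSum_exp' (𝕂 := ℂ)
    (LinearMap.toMatrix (Module.finBasis ℂ E) (Module.finBasis ℂ E) A)
  have h2 := h.map (Matrix.traceAddMonoidHom _ ℂ) (Continuous.matrix_trace continuous_id)
  refine h2.congr_fun ?_
  intro k
  simp [Matrix.trace_smul, LinearMap.trace_eq_matrix_trace ℂ (Module.finBasis ℂ E),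
    LinearMap.toMatrix_pow]

theorem _root_.DualBound.norm_trace_expEnd_le {ι : Type*} [Finite ι] {x : ι → E}
    (hx : Submodule.span ℂ (Set.range x) = ⊤) {A : Module.End ℂ E} {R : ℝ} (hR : 0 ≤ R)
    (h : DualBound x A R) :
    ‖LinearMap.trace ℂ E (expEnd A)‖ ≤ Module.finrank ℂ E * Real.exp R := by
  have h1 : HasSum (fun k : ℕ => (Module.finrank ℂ E : ℝ) * (R ^ k / k.factorial))
      (Module.finrank ℂ E * Real.exp R) := by
    rw [Real.exp_eq_exp_ℝ]
    exact (NormedSpace.expSeries_div_hasSum_exp R).mul_left _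
  refine (hasSum_trace_expEnd A).norm_le_of_bounded h1 fun k => ?_
  have := (h.pow k).norm_trace_le hx (pow_nonneg hR k)
  rw [norm_mul, norm_inv, Complex.norm_natCast]
  calc (k.factorial : ℝ)⁻¹ * _ ≤ (k.factorial : ℝ)⁻¹ * (Module.finrank ℂ E * R ^ k) :=
        mul_le_mul_of_nonneg_left this (by positivity)
    _ = _ := by ring

theorem differentiable_trace_expEnd {F : Type*} [NormedAddCommGroup F] [NormedSpace ℂ F]
    [FiniteDimensional ℂ F] (A : F →ₗ[ℂ] Module.End ℂ E) :
    Differentiable ℂ fun p => LinearMap.trace ℂ E (expEnd (A p)) := by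
  simp only [trace_expEnd]
  intro p
  let T := (LinearMap.toMatrix (Module.finBasis ℂ E) (Module.finBasis ℂ E)).toLinearMap ∘ₗ A
  have hT : DifferentiableAt ℂ (fun p => T p) p := T.toContinuousLinearMap.differentiableAt
  have hexp := (NormedSpace.exp_analytic (𝕂 := ℂ) (T p)).differentiableAt
  have htr := (LinearMap.toContinuousLinearMap (Matrix.traceLinearMap
    (Fin (Module.finrank ℂ E)) ℂ ℂ)).differentiableAt (x := NormedSpace.exp (T p))
  have h := DifferentiableAt.comp p htr (DifferentiableAt.comp p hexp hT)
  exact h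

end Exponential
end VOA

/-! ### Counting lists with distinct parts -/

theorem List.Nodup.length_le_sqrt {l : List ℕ} (h : l.Nodup) :
    l.length ≤ Nat.sqrt (2 * l.sum) + 1 := by
  classical
  have h1 : (∑ i ∈ Finset.range l.toFinset.card, (i : ℕ)) ≤ ∑ i ∈ l.toFinset, i := by
    have := Finset.sum_range_le_sum (s := l.toFinset.map Nat.castEmbedding) (c := 0) (by simp)
    simp only [Finset.card_map, zero_add, Finset.sum_map, Nat.castEmbedding_apply] at this
    zify
    exact this
  rw [List.toFinset_card_of_nodup h, List.sum_toFinset _ h, List.map_id'] at h1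
  have h2 := Finset.sum_range_id_mul_two l.length
  -- The sum of `k` distinct natural numbers is at least `0 + 1 + ⋯ + (k - 1) = k (k - 1) / 2`.
  have h3 : (l.length - 1) * (l.length - 1) ≤ 2 * l.sum :=
    (Nat.mul_le_mul_right _ (Nat.sub_le _ _)).trans (by omega)
  have := Nat.le_sqrt.mpr h3
  omega

/-- Lists of pairs whose second components are distinct and have sum `n`. -/
abbrev DistinctParts (ι : Type*) (n : ℕ) : Type _ :=
  {l : List (ι × ℕ) // (l.map Prod.snd).Nodup ∧ (l.map Prod.snd).sum = n}

namespace DistinctParts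

variable {ι : Type*} {n : ℕ}

theorem length_le (l : DistinctParts ι n) : l.1.length ≤ Nat.sqrt (2 * n) + 1 := by
  simpa [l.2.2] using l.2.1.length_le_sqrt

theorem snd_le (l : DistinctParts ι n) {p : ι × ℕ} (hp : p ∈ l.1) : p.2 ≤ n :=
  (List.le_sum_of_mem (List.mem_map_of_mem hp)).trans l.2.2.le

/-- The entries of the list, padded with `none`. -/
def entries (l : DistinctParts ι n) (i : Fin (Nat.sqrt (2 * n) + 1)) :
    Option (ι × Fin (n + 1)) :=
  (l.1[(i : ℕ)]?).map fun p => (p.1, Fin.ofNat (n + 1) p.2)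

theorem entries_injective : Function.Injective (entries : DistinctParts ι n → _) := by
  intro l l' h
  refine Subtype.ext (List.ext_getElem? fun i => ?_)
  rcases lt_or_ge i (Nat.sqrt (2 * n) + 1) with hi | hi
  · have := congrFun h ⟨i, hi⟩
    simp only [entries] at this
    rcases h1 : l.1[i]? with _ | p <;> rcases h2 : l'.1[i]? with _ | p' <;>
      rw [h1, h2] at this <;> simp at this ⊢
    have e1 := l.snd_le (List.mem_of_getElem? h1)
    have e2 := l'.snd_le (List.mem_of_getElem? h2)
    have e3 := congrArg Fin.val this.2
    change p.2 % (n + 1) = p'.2 % (n + 1) at e3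
    rw [Nat.mod_eq_of_lt (by omega), Nat.mod_eq_of_lt (by omega)] at e3
    exact Prod.ext this.1 e3
  · rw [List.getElem?_eq_none (l.length_le.trans hi), List.getElem?_eq_none (l'.length_le.trans hi)]

instance [Finite ι] : Finite (DistinctParts ι n) := Finite.of_injective _ entries_injective

theorem card_le [Fintype ι] : Nat.card (DistinctParts ι n) ≤
    (Fintype.card ι * (n + 1) + 1) ^ (Nat.sqrt (2 * n) + 1) := by
  refine (Nat.card_le_card_of_injective _ entries_injective).trans_eq ?_
  simp

end DistinctParts

namespace VOA

open VertexOperatorAlgebra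

variable {V : Type u} [AddCommGroup V] [Module ℂ V] [VertexOperatorAlgebra V]
variable {M : Type v} [AddCommGroup M] [Module ℂ M] [VOAModule V M]

instance (n : ℤ) : Module.Finite ℂ (weightSpace V V (n : ℂ)) := finite_graded n

/-- The derivation property `[a₀, xₙ] = (a₀ x)ₙ`. As `a₀` preserves the weights of `V`, the new mode
has the same weight and degree as the old one. -/
theorem zero_mode_op (a : WeightOne V) (x : Letter V) (u : M) :
    mode M (a : V) 0 (x.op M u) = x.op M (mode M (a : V) 0 u) +
      mode M (mode V (a : V) 0 x.vec) (x.wt - 1 - x.deg) u := by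
  have h := commutator_mode (a : V) x.vec u 0 (x.wt - 1 - x.deg)
  rw [finsum_eq_single _ 0 (fun j hj => by
    rw [Ring.choose_zero_pos ℤ (Nat.pos_of_ne_zero hj), zero_smul])] at h
  simp only [Ring.choose_zero_right, one_smul, Nat.cast_zero, zero_add, sub_zero] at h
  rw [← h, Letter.op]
  abel

/-! ### Words in basis vectors -/

variable (V) in
/-- Labels of the basis vectors of weight at most `K`. -/
abbrev BasisIndex (K : ℕ) : Type :=
  Σ k : Fin (K + 1), Fin (Module.finrank ℂ (homogeneous V (k : ℕ)))

/-- The letter formed by a basis vector and a degree. -/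
def basisLetter {K : ℕ} (p : BasisIndex V K × ℕ) : Letter V :=
  ⟨p.1.1, p.2, Module.finBasis ℂ (homogeneous V (p.1.1 : ℕ)) p.1.2, Subtype.property _⟩

variable (M) in
/-- The word in basis vectors described by `l`, applied to the basis vector of `M_μ` with label
`j`. -/
def basisWord [IsOrdinaryModule V M] {K : ℕ} (μ : ℂ) (l : List (BasisIndex V K × ℕ))
    (j : Fin (Module.finrank ℂ (weightSpace V M μ))) : M :=
  wordOp M (l.map basisLetter) (Module.finBasis ℂ (weightSpace V M μ) j : M)

section

variable [IsOrdinaryModule V M] {K : ℕ} {μ : ℂ}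

theorem basisWord_cons (p : BasisIndex V K × ℕ) (l : List (BasisIndex V K × ℕ))
    (j : Fin (Module.finrank ℂ (weightSpace V M μ))) :
    basisWord M μ (p :: l) j = (basisLetter p).op M (basisWord M μ l j) := by
  simp [basisWord]

theorem wordDeg_map_basisLetter (l : List (BasisIndex V K × ℕ)) :
    wordDeg (l.map basisLetter) = ((l.map Prod.snd).sum : ℕ) := by
  induction l with
  | nil => simp
  | cons p l ih => simp [ih, basisLetter]

theorem basisWord_mem (l : List (BasisIndex V K × ℕ))
    (j : Fin (Module.finrank ℂ (weightSpace V M μ))) :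
    basisWord M μ l j ∈ weightSpace V M (μ + ((l.map Prod.snd).sum : ℕ)) := by
  have := wordOp_mem (l := l.map basisLetter)
    (Module.finBasis ℂ (weightSpace V M μ) j : weightSpace V M μ).2
  rwa [wordDeg_map_basisLetter, Int.cast_natCast] at this

/-- Expanding a word in basis vectors. -/
theorem wordOp_mem_span_basisWord {l : List (Letter V)}
    (hl : ∀ x ∈ l, x.wt ≤ K ∧ 0 ≤ x.deg) {w : M} (hw : w ∈ weightSpace V M μ) :
    wordOp M l w ∈ Submodule.span ℂ {m | ∃ (l' : List (BasisIndex V K × ℕ)) (j : _),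
      l'.map (fun p => (p.2 : ℤ)) = l.map Letter.deg ∧ m = basisWord M μ l' j} := by
  induction l with
  | nil =>
    have h := (Module.finBasis ℂ (weightSpace V M μ)).sum_repr ⟨w, hw⟩
    have h' := congrArg (weightSpace V M μ).subtype h
    simp only [map_sum, map_smul, Submodule.subtype_apply] at h'
    rw [wordOp_nil, Module.End.one_apply, ← h']
    exact Submodule.sum_mem _ fun j _ => Submodule.smul_mem _ _
      (Submodule.subset_span ⟨[], j, rfl, by simp [basisWord]⟩)
  | cons x l ih =>
    rw [wordOp_cons, Module.End.mul_apply]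
    have h1 := ih fun y hy => hl y (List.mem_cons_of_mem _ hy)
    revert h1
    generalize wordOp M l w = m
    intro h1
    rw [← Submodule.mem_comap]
    refine (Submodule.span_le.mpr ?_) h1
    rintro _ ⟨l', j, hl', rfl⟩
    obtain ⟨hxK, hxd⟩ := hl x List.mem_cons_self
    obtain ⟨d, hd⟩ := Int.eq_ofNat_of_zero_le hxd
    have h := (Module.finBasis ℂ (homogeneous V x.wt)).sum_repr ⟨x.vec, x.mem⟩
    have h' := congrArg (modeFlip M (x.wt - 1 - x.deg) (basisWord M μ l' j) ∘ₗ
      (homogeneous V x.wt).subtype) h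
    rw [map_sum] at h'
    simp only [map_smul] at h'
    rw [SetLike.mem_coe, Submodule.mem_comap,
      show x.op M (basisWord M μ l' j) = _ from h'.symm]
    refine Submodule.sum_mem _ fun i _ => Submodule.smul_mem _ _ (Submodule.subset_span
      ⟨(⟨⟨x.wt, by omega⟩, i⟩, d) :: l', j, by simp [hl', hd], ?_⟩)
    rw [basisWord_cons, Letter.op]
    simp [basisLetter, hd]

/-- The reduced words in basis vectors, as elements of a weight space. -/
def reducedBasisWord (n : ℕ)
    (p : DistinctParts (BasisIndex V K) n × Fin (Module.finrank ℂ (weightSpace V M μ))) :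
    weightSpace V M (μ + n) :=
  ⟨basisWord M μ p.1.1 p.2, by
    have := basisWord_mem (M := M) p.1.1 p.2
    rwa [p.1.2.2] at this⟩

theorem span_reducedBasisWord {n : ℕ}
    (h : weightSpace V M (μ + n) = reducedSpan V (weightSpace V M μ) K n) :
    Submodule.span ℂ (Set.range (reducedBasisWord (V := V) (M := M) (K := K) (μ := μ) n)) = ⊤ := by
  have hinj : Function.Injective (Submodule.map (weightSpace V M (μ + n)).subtype) :=
    Submodule.map_injective_of_injective (Submodule.injective_subtype _)
  apply hinj
  rw [Submodule.map_top, Submodule.range_subtype]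
  refine le_antisymm (Submodule.map_subtype_le _ _) ?_
  conv_lhs => rw [h]
  refine Submodule.span_le.mpr ?_
  rintro _ ⟨l, w, hw, hl, hD, rfl⟩
  refine Submodule.span_le.mpr ?_ (wordOp_mem_span_basisWord (K := K) hl.1 hw)
  rintro _ ⟨l', j, hl', rfl⟩
  have hcast : (l'.map Prod.snd).map (Nat.cast : ℕ → ℤ) = l.map Letter.deg := by
    rw [← hl', List.map_map]; rfl
  have h1 : (l'.map Prod.snd).Nodup := by
    refine List.Nodup.of_map (Nat.cast : ℕ → ℤ) ?_
    rw [hcast]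
    exact hl.2
  have h2 : (l'.map Prod.snd).sum = n := by
    have : (((l'.map Prod.snd).sum : ℕ) : ℤ) = n := by
      rw [← hD, Nat.cast_list_sum, hcast, wordDeg]
    exact_mod_cast this
  refine ⟨reducedBasisWord n ⟨⟨l', h1, h2⟩, j⟩, Submodule.subset_span ⟨_, rfl⟩, rfl⟩

theorem finrank_weightSpace_le {n : ℕ}
    (h : weightSpace V M (μ + n) = reducedSpan V (weightSpace V M μ) K n) :
    Module.finrank ℂ (weightSpace V M (μ + n)) ≤
      (Fintype.card (BasisIndex V K) * (n + 1) + 1) ^ (Nat.sqrt (2 * n) + 1) *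
        Module.finrank ℂ (weightSpace V M μ) := by
  have := Fintype.ofFinite (DistinctParts (BasisIndex V K) n)
  have h1 := finrank_range_le_card (R := ℂ)
    (reducedBasisWord (V := V) (M := M) (K := K) (μ := μ) n)
  rw [Set.finrank, span_reducedBasisWord h, finrank_top, Fintype.card_prod, Fintype.card_fin,
    ← Nat.card_eq_fintype_card] at h1
  exact h1.trans (Nat.mul_le_mul_right _ DistinctParts.card_le)

variable (M K μ) in
/-- `C` bounds the zero mode of `a` on `V_0, …, V_K` and on `M_μ`. -/
structure ZeroModeBound (a : WeightOne V) (C : ℝ) : Prop where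
  algebra : ∀ k ≤ K, DualBound (Module.finBasis ℂ (weightSpace V V ((k : ℤ) : ℂ)))
    (zeroMode V a ((k : ℤ) : ℂ)) C
  module : DualBound (Module.finBasis ℂ (weightSpace V M μ)) (zeroMode M a μ) C

/-- By the derivation property `a₀` acts on one letter at a time, or on the vector of `M_μ`, which
accounts for the factor `l.length + 1`. Each contribution only involves words with the same sequence
of degrees. The functional varies in the induction, because the leading letter is absorbed into it.
-/
theorem norm_apply_zero_mode_basisWord_le {a : WeightOne V} {C : ℝ} (hC : ZeroModeBound M K μ a C)
    (l : List (BasisIndex V K × ℕ)) (φ : Module.Dual ℂ M) {B : ℝ}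
    (hB : ∀ (l' : List (BasisIndex V K × ℕ)) j, l'.map Prod.snd = l.map Prod.snd →
      ‖φ (basisWord M μ l' j)‖ ≤ B) (j : Fin (Module.finrank ℂ (weightSpace V M μ))) :
    ‖φ (mode M (a : V) 0 (basisWord M μ l j))‖ ≤ (l.length + 1) * C * B := by
  induction l generalizing φ with
  | nil =>
    have := hC.module (φ ∘ₗ (weightSpace V M μ).subtype) B (fun j => by
      simpa [basisWord] using hB [] j rfl) j
    simpa [basisWord, zeroMode] using this
  | cons p l ih =>
    rw [basisWord_cons, zero_mode_op, map_add]
    have h1 := ih (φ ∘ₗ (basisLetter p).op M) fun l' j hl' => by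
      have := hB (p :: l') j (by simp [hl'])
      rwa [basisWord_cons] at this
    have h2 := hC.algebra p.1.1 (by omega)
      (φ ∘ₗ modeFlip M ((basisLetter p).wt - 1 - (basisLetter p).deg) (basisWord M μ l j) ∘ₗ
        (homogeneous V (p.1.1 : ℕ)).subtype) B (fun i => by
      have := hB ((⟨p.1.1, i⟩, p.2) :: l) j (by simp)
      rwa [basisWord_cons] at this) p.1.2
    refine (norm_add_le _ _).trans ?_
    have h3 := add_le_add h1 h2
    simp only [List.length_cons]
    push_cast
    refine le_trans h3 (le_of_eq (by ring))

theorem dualBound_reducedBasisWord {a : WeightOne V} {C : ℝ} (hC0 : 0 ≤ C)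
    (hC : ZeroModeBound M K μ a C) (n : ℕ) :
    DualBound (reducedBasisWord (V := V) (M := M) (K := K) (μ := μ) n) (zeroMode M a (μ + n))
      ((Nat.sqrt (2 * n) + 2) * C) := by
  intro φ B hB p
  -- The induction on words passes through other weight spaces, so the functional is extended to all
  -- of `M`.
  obtain ⟨ψ, hψ⟩ := LinearMap.exists_extend φ
  have hψ' : ∀ m : weightSpace V M (μ + n), ψ m = φ m := fun m => LinearMap.congr_fun hψ m
  have h := norm_apply_zero_mode_basisWord_le hC p.1.1 ψ (B := B) (fun l' j hl' => by
    have := hB ⟨⟨l', hl' ▸ p.1.2.1, hl' ▸ p.1.2.2⟩, j⟩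
    rwa [← hψ'] at this) p.2
  rw [← hψ']
  have hB0 : 0 ≤ B := (norm_nonneg _).trans (hB p)
  refine h.trans ?_
  have : (p.1.1.length : ℝ) ≤ Nat.sqrt (2 * n) + 1 := by exact_mod_cast p.1.length_le
  exact mul_le_mul_of_nonneg_right (mul_le_mul_of_nonneg_right (by linarith) hC0) hB0

theorem norm_trace_expEnd_zeroMode_le {a : WeightOne V} {C : ℝ} (hC0 : 0 ≤ C)
    (hC : ZeroModeBound M K μ a C) {n : ℕ}
    (h : weightSpace V M (μ + n) = reducedSpan V (weightSpace V M μ) K n) :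
    ‖LinearMap.trace ℂ (weightSpace V M (μ + n))
      (expEnd ((2 * Real.pi * Complex.I : ℂ) • zeroMode M a (μ + n)))‖ ≤
    (Fintype.card (BasisIndex V K) * (n + 1) + 1 : ℝ) ^ (Nat.sqrt (2 * n) + 1) *
        Module.finrank ℂ (weightSpace V M μ) *
      Real.exp (2 * Real.pi * ((Nat.sqrt (2 * n) + 2) * C)) := by
  have h1 := ((dualBound_reducedBasisWord hC0 hC n).smul
    (2 * Real.pi * Complex.I : ℂ)).norm_trace_expEnd_le (span_reducedBasisWord h) (by positivity)
  have e : ‖(2 * Real.pi * Complex.I : ℂ)‖ = 2 * Real.pi := by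
    simp [abs_of_pos Real.pi_pos]
  rw [e] at h1
  refine h1.trans (mul_le_mul_of_nonneg_right ?_ (Real.exp_pos _).le)
  exact_mod_cast finrank_weightSpace_le h

end

end VOA

/-! ### Series of holomorphic functions of several variables -/

section Series

variable {E : Type*} [NormedAddCommGroup E] [NormedSpace ℂ E]

/-- Cauchy's estimate on the complex line through `y` in the direction `v`, on the disc of radius `r
/ ‖v‖`. -/
theorem norm_fderiv_le_of_bounded_on_ball {f : E → ℂ} {x y : E} {r B : ℝ} (hr : 0 < r)
    (hf : DifferentiableOn ℂ f (Metric.ball x (r + r))) (hB : ∀ z ∈ Metric.ball x (r + r), ‖f z‖ ≤ B)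
    (hy : y ∈ Metric.ball x r) : ‖fderiv ℂ f y‖ ≤ B / r := by
  have hyb : y ∈ Metric.ball x (r + r) := Metric.ball_subset_ball (by linarith) hy
  have hB0 : 0 ≤ B := (norm_nonneg _).trans (hB y hyb)
  refine ContinuousLinearMap.opNorm_le_bound _ (by positivity) fun v => ?_
  rcases eq_or_ne v 0 with rfl | hv
  · simp
  have hv' : 0 < ‖v‖ := norm_pos_iff.mpr hv
  have hmem : ∀ t : ℂ, ‖t‖ ≤ r / ‖v‖ → y + t • v ∈ Metric.ball x (r + r) := by
    intro t ht
    rw [Metric.mem_ball, dist_eq_norm] at hy ⊢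
    calc ‖y + t • v - x‖ = ‖(y - x) + t • v‖ := by congr 1; abel
      _ ≤ ‖y - x‖ + ‖t‖ * ‖v‖ := (norm_add_le _ _).trans_eq (by rw [norm_smul])
      _ < r + r := add_lt_add_of_lt_of_le hy ((le_div_iff₀ hv').mp ht)
  have hline : ∀ t : ℂ, HasDerivAt (fun t : ℂ => y + t • v) v t := fun t => by
    simpa using ((hasDerivAt_id t).smul_const v).const_add y
  have hdiff : ∀ z ∈ Metric.ball x (r + r), DifferentiableAt ℂ f z := fun z hz =>
    hf.differentiableAt (Metric.isOpen_ball.mem_nhds hz)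
  have hg : ∀ t : ℂ, ‖t‖ ≤ r / ‖v‖ →
      HasDerivAt (fun t : ℂ => f (y + t • v)) (fderiv ℂ f (y + t • v) v) t := fun t ht =>
    (hdiff _ (hmem t ht)).hasFDerivAt.comp_hasDerivAt t (hline t)
  have hρ : 0 < r / ‖v‖ := by positivity
  have h := Complex.norm_deriv_le_of_forall_mem_sphere_norm_le (c := 0) (C := B)
    (f := fun t : ℂ => f (y + t • v)) hρ
    (DifferentiableOn.diffContOnCl fun t ht => by
      rw [closure_ball _ hρ.ne', mem_closedBall_zero_iff] at ht
      exact (hg t ht).differentiableAt.differentiableWithinAt)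
    (fun t ht => hB _ (hmem t (mem_sphere_zero_iff_norm.mp ht).le))
  rw [(hg 0 (by simpa using hρ.le)).deriv, zero_smul, add_zero] at h
  refine h.trans_eq ?_
  field_simp

/-- On a ball of half the radius Cauchy's estimate turns the bounds for the terms into summable
bounds for their derivatives, so the series can be differentiated term by term. -/
theorem differentiableOn_tsum_of_locally_bounded {F : ℕ → E → ℂ} {s : Set E}
    (hF : ∀ n, DifferentiableOn ℂ (F n) s)
    (hb : ∀ x ∈ s, ∃ t ∈ nhds x, t ⊆ s ∧ ∃ u : ℕ → ℝ, Summable u ∧ ∀ n, ∀ y ∈ t, ‖F n y‖ ≤ u n) :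
    DifferentiableOn ℂ (fun x => ∑' n, F n x) s := by
  intro x hx
  obtain ⟨t, ht, hts, u, hu, hFu⟩ := hb x hx
  obtain ⟨R, hR, hRt⟩ := Metric.mem_nhds_iff.mp ht
  set r := R / 2 with hr
  have hr0 : 0 < r := by positivity
  have hrt : Metric.ball x (r + r) ⊆ t := by rwa [hr, add_halves]
  have hsub : Metric.ball x r ⊆ Metric.ball x (r + r) := Metric.ball_subset_ball (by linarith)
  have hxr : x ∈ Metric.ball x r := Metric.mem_ball_self hr0
  have h := hasFDerivAt_tsum_of_isPreconnected (f := F) (f' := fun n y => fderiv ℂ (F n) y)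
    (hu.div_const r) Metric.isOpen_ball (Metric.isPreconnected_ball (x := x) (r := r))
    (fun n y hy => (((hF n).mono (hrt.trans hts)).differentiableAt
      (Metric.isOpen_ball.mem_nhds (hsub hy))).hasFDerivAt)
    (fun n y hy => norm_fderiv_le_of_bounded_on_ball hr0 ((hF n).mono (hrt.trans hts))
      (fun z hz => hFu n z (hrt hz)) hy) hxr
    (Summable.of_norm_bounded hu fun n => hFu n x (hrt (hsub hxr))) hxr
  exact h.differentiableAt.differentiableWithinAt

end Series

/-! ### Subexponential growth -/

/-- The square root is at most a multiple of `(n + 1)^(1/2)` and the logarithm at most a multiple of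
`(n + 1)^(1/4)`. Any exponent below one for the product would do. -/
theorem sqrt_mul_log_le {A c : ℝ} (hA : 0 ≤ A) (hc : 0 ≤ c) :
    ∃ D, 0 ≤ D ∧ ∀ n : ℕ, (Nat.sqrt (2 * n) + 2 : ℝ) * (Real.log (A * (n + 1) + 1) + c) ≤
      D * (n + 1 : ℝ) ^ (3 / 4 : ℝ) := by
  have hlogA : 0 ≤ Real.log (A + 1) := Real.log_nonneg (by linarith)
  refine ⟨4 * (Real.log (A + 1) + 4 + c), by positivity, fun n => ?_⟩
  set t : ℝ := n + 1 with ht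
  have ht1 : 1 ≤ t := by rw [ht]; linarith [(Nat.cast_nonneg n : (0 : ℝ) ≤ n)]
  have ht0 : 0 < t := by linarith
  have hroot : 1 ≤ t ^ (1 / 4 : ℝ) := Real.one_le_rpow ht1 (by norm_num)
  have h1 : (Nat.sqrt (2 * n) + 2 : ℝ) ≤ 4 * t ^ (1 / 2 : ℝ) := by
    have hs : (Nat.sqrt (2 * n) : ℝ) ≤ 2 * Real.sqrt t := by
      rw [← Real.sqrt_sq (Nat.cast_nonneg (Nat.sqrt (2 * n))), show (2 : ℝ) = Real.sqrt (2 ^ 2) by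
        rw [Real.sqrt_sq (by norm_num)], ← Real.sqrt_mul (by norm_num)]
      refine Real.sqrt_le_sqrt ?_
      have : ((Nat.sqrt (2 * n) ^ 2 : ℕ) : ℝ) ≤ (2 * n : ℕ) := by
        exact_mod_cast Nat.sqrt_le' (2 * n)
      push_cast at this
      rw [ht]
      linarith [(Nat.cast_nonneg n : (0 : ℝ) ≤ n)]
    have h1s : 1 ≤ Real.sqrt t := Real.one_le_sqrt.mpr ht1
    rw [← Real.sqrt_eq_rpow]
    linarith
  have h2 : Real.log (A * t + 1) + c ≤ (Real.log (A + 1) + 4 + c) * t ^ (1 / 4 : ℝ) := by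
    have h3 : Real.log (A * t + 1) ≤ Real.log (A + 1) + Real.log t := by
      rw [← Real.log_mul (by positivity) (by positivity)]
      exact Real.log_le_log (by positivity) (by nlinarith)
    have h4 : Real.log t ≤ t ^ (1 / 4 : ℝ) / (1 / 4) := Real.log_le_rpow_div ht0.le (by norm_num)
    nlinarith
  have h5 : 0 ≤ Real.log (A * t + 1) + c :=
    add_nonneg (Real.log_nonneg (by nlinarith)) hc
  calc _ ≤ 4 * t ^ (1 / 2 : ℝ) * ((Real.log (A + 1) + 4 + c) * t ^ (1 / 4 : ℝ)) :=
        mul_le_mul h1 h2 h5 (by positivity)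
    _ = 4 * (Real.log (A + 1) + 4 + c) * (t ^ (1 / 2 : ℝ) * t ^ (1 / 4 : ℝ)) := by ring
    _ = _ := by rw [← Real.rpow_add ht0]; norm_num

/-- The logarithm of the growing factors is eventually at most `δ / 2 * (n + 1)`, which leaves a
geometric series of ratio `exp (-δ / 2)`. -/
theorem summable_subexponential_mul_exp {A c δ : ℝ} (hA : 0 ≤ A) (hc : 0 ≤ c) (hδ : 0 < δ) :
    Summable fun n : ℕ => (A * (n + 1) + 1) ^ (Nat.sqrt (2 * n) + 1) *
      Real.exp (c * (Nat.sqrt (2 * n) + 2)) * Real.exp (-δ * n) := by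
  obtain ⟨D, hD, hbound⟩ := sqrt_mul_log_le hA hc
  have hev : ∀ᶠ n : ℕ in Filter.atTop, D * (n + 1 : ℝ) ^ (3 / 4 : ℝ) ≤ δ / 2 * (n + 1) := by
    have h1 : Filter.Tendsto (fun n : ℕ => (n + 1 : ℝ) ^ (1 / 4 : ℝ)) Filter.atTop Filter.atTop :=
      (tendsto_rpow_atTop (by norm_num)).comp
        (Filter.tendsto_atTop_add_const_right _ 1 tendsto_natCast_atTop_atTop)
    filter_upwards [h1.eventually_ge_atTop (D / (δ / 2))] with n hn
    have ht0 : (0 : ℝ) < n + 1 := by positivity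
    have h2 : (n + 1 : ℝ) = (n + 1 : ℝ) ^ (3 / 4 : ℝ) * (n + 1 : ℝ) ^ (1 / 4 : ℝ) := by
      rw [← Real.rpow_add ht0]; norm_num
    have h3 : D ≤ δ / 2 * (n + 1 : ℝ) ^ (1 / 4 : ℝ) := by
      rwa [div_le_iff₀' (by positivity)] at hn
    calc D * (n + 1 : ℝ) ^ (3 / 4 : ℝ) ≤
        δ / 2 * (n + 1 : ℝ) ^ (1 / 4 : ℝ) * (n + 1 : ℝ) ^ (3 / 4 : ℝ) := by gcongr
      _ = δ / 2 * ((n + 1 : ℝ) ^ (3 / 4 : ℝ) * (n + 1 : ℝ) ^ (1 / 4 : ℝ)) := by ring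
      _ = _ := by rw [← h2]
  have hgeom : Summable fun n : ℕ => Real.exp (δ / 2) * Real.exp (n * -(δ / 2)) :=
    (Real.summable_exp_nat_mul_iff.mpr (by linarith)).mul_left _
  refine hgeom.of_norm_bounded_eventually_nat ?_
  filter_upwards [hev] with n hn
  have hbase : 1 ≤ A * (n + 1) + 1 := by
    have : 0 ≤ A * (n + 1) := by positivity
    linarith
  have hlog := Real.log_nonneg hbase
  rw [Real.norm_of_nonneg (by positivity), ← Real.exp_log (pow_pos (by linarith) _), Real.log_pow,
    ← Real.exp_add, ← Real.exp_add, ← Real.exp_add]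
  refine Real.exp_le_exp.mpr ?_
  have := hbound n
  push_cast
  nlinarith

namespace VOA

open VertexOperatorAlgebra

variable {V : Type u} [AddCommGroup V] [Module ℂ V] [VertexOperatorAlgebra V]
variable {M : Type v} [AddCommGroup M] [Module ℂ M] [VOAModule V M]

/-! ### Convergence of characters -/

theorem zeroMode_add (a b : WeightOne V) (μ : ℂ) :
    zeroMode M (a + b) μ = zeroMode M a μ + zeroMode M b μ := by
  ext w
  simp [zeroMode, mode_add]

theorem zeroMode_smul (r : ℂ) (a : WeightOne V) (μ : ℂ) :
    zeroMode M (r • a) μ = r • zeroMode M a μ := by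
  ext w
  simp [zeroMode, mode_smul]

theorem zeroMode_zero (μ : ℂ) : zeroMode M (0 : WeightOne V) μ = 0 := by
  ext w
  simp [zeroMode, mode_zero]

variable (M) in
/-- The zero mode on `M_μ`, as a linear map in the vector of weight one. -/
def zeroModeLinear (μ : ℂ) : WeightOne V →ₗ[ℂ] Module.End ℂ (weightSpace V M μ) where
  toFun a := zeroMode M a μ
  map_add' a b := zeroMode_add a b μ
  map_smul' r a := zeroMode_smul r a μ

variable {K : ℕ} {μ : ℂ}

variable (M K μ) in
/-- A summable bound for the terms of the character, uniform for zero modes bounded by `C` and for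
`τ` with `‖τ‖ ≤ T` and `ε ≤ Im τ`. -/
def characterBound (C T ε : ℝ) (n : ℕ) : ℝ :=
  Module.finrank ℂ (weightSpace V M μ) * Real.exp (2 * Real.pi * T * ‖μ - centralCharge V / 24‖) *
    ((Fintype.card (BasisIndex V K) * (n + 1) + 1 : ℝ) ^ (Nat.sqrt (2 * n) + 1) *
      Real.exp (2 * Real.pi * C * (Nat.sqrt (2 * n) + 2)) * Real.exp (-(2 * Real.pi * ε) * n))

theorem summable_characterBound {C T ε : ℝ} (hC : 0 ≤ C) (hε : 0 < ε) :
    Summable (characterBound (V := V) M K μ C T ε) :=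
  (summable_subexponential_mul_exp (Nat.cast_nonneg _) (by positivity)
    (by positivity)).mul_left _

variable [IsOrdinaryModule V M]

theorem characterTerm_eq_zero {a : WeightOne V} {τ ν : ℂ} (h : weightSpace V M ν = ⊥) :
    characterTerm M a τ ν = 0 := by
  have : Subsingleton (weightSpace V M ν) := by
    rw [h]
    infer_instance
  rw [characterTerm, Subsingleton.elim (expEnd _) 0, map_zero, zero_mul]

theorem ZeroModeBound.add {a b : WeightOne V} {C D : ℝ} (ha : ZeroModeBound M K μ a C)
    (hb : ZeroModeBound M K μ b D) : ZeroModeBound M K μ (a + b) (C + D) where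
  algebra k hk := zeroMode_add (M := V) a b _ ▸ (ha.algebra k hk).add (hb.algebra k hk)
  module := zeroMode_add (M := M) a b _ ▸ ha.module.add hb.module

theorem ZeroModeBound.smul {a : WeightOne V} {C : ℝ} (ha : ZeroModeBound M K μ a C) (c : ℂ) :
    ZeroModeBound M K μ (c • a) (‖c‖ * C) where
  algebra k hk := zeroMode_smul (M := V) c a _ ▸ (ha.algebra k hk).smul c
  module := zeroMode_smul (M := M) c a _ ▸ ha.module.smul c

theorem ZeroModeBound.zero : ZeroModeBound M K μ (0 : WeightOne V) 0 where
  algebra _ _ := zeroMode_zero (V := V) (M := V) _ ▸ DualBound.zero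
  module := zeroMode_zero (V := V) (M := M) _ ▸ DualBound.zero

theorem ZeroModeBound.mono {a : WeightOne V} {C D : ℝ} (ha : ZeroModeBound M K μ a C)
    (h : C ≤ D) : ZeroModeBound M K μ a D where
  algebra k hk := (ha.algebra k hk).mono h
  module := ha.module.mono h

theorem ZeroModeBound.sum {ι : Type*} {s : Finset ι} {a : ι → WeightOne V} {C : ι → ℝ}
    (h : ∀ i ∈ s, ZeroModeBound M K μ (a i) (C i)) :
    ZeroModeBound M K μ (∑ i ∈ s, a i) (∑ i ∈ s, C i) := by
  classical
  induction s using Finset.induction_on with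
  | empty => simpa using ZeroModeBound.zero
  | insert i s hi ih =>
    rw [Finset.sum_insert hi, Finset.sum_insert hi]
    exact (h i (Finset.mem_insert_self i s)).add
      (ih fun j hj => h j (Finset.mem_insert_of_mem hj))

theorem exists_zeroModeBound (a : WeightOne V) : ∃ C, 0 ≤ C ∧ ZeroModeBound M K μ a C := by
  choose R hR0 hR using fun k : ℕ => exists_dualBound
    (Module.finBasis ℂ (weightSpace V V ((k : ℤ) : ℂ))) (zeroMode V a ((k : ℤ) : ℂ))
  obtain ⟨S, hS0, hS⟩ := exists_dualBound (Module.finBasis ℂ (weightSpace V M μ)) (zeroMode M a μ)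
  have hsum : 0 ≤ ∑ k ∈ Finset.range (K + 1), R k := Finset.sum_nonneg fun k _ => hR0 k
  refine ⟨∑ k ∈ Finset.range (K + 1), R k + S, by positivity,
    fun k hk => (hR k).mono ?_, hS.mono (by linarith)⟩
  have := Finset.single_le_sum (f := R) (fun k _ => hR0 k)
    (Finset.mem_range.mpr (show k < K + 1 by omega))
  linarith

theorem norm_characterTerm_le {a : WeightOne V} {C T ε : ℝ} (hC0 : 0 ≤ C)
    (hC : ZeroModeBound M K μ a C) {τ : ℂ} (hT : ‖τ‖ ≤ T) (hε : ε ≤ τ.im) {n : ℕ}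
    (h : weightSpace V M (μ + n) = reducedSpan V (weightSpace V M μ) K n) :
    ‖characterTerm M a τ (μ + n)‖ ≤ characterBound (V := V) M K μ C T ε n := by
  rw [characterTerm, norm_mul]
  have h1 := norm_trace_expEnd_zeroMode_le hC0 hC h
  have h2 : ‖Complex.exp (2 * Real.pi * Complex.I * τ * (μ + n - centralCharge V / 24))‖ ≤
      Real.exp (2 * Real.pi * T * ‖μ - centralCharge V / 24‖) *
        Real.exp (-(2 * Real.pi * ε) * n) := by
    rw [show 2 * Real.pi * Complex.I * τ * (μ + n - centralCharge V / 24) =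
      2 * Real.pi * Complex.I * τ * (μ - centralCharge V / 24) +
        2 * Real.pi * Complex.I * τ * n by ring, Complex.exp_add, norm_mul]
    refine mul_le_mul ?_ ?_ (norm_nonneg _) (Real.exp_pos _).le
    · rw [Complex.norm_exp]
      refine Real.exp_le_exp.mpr ((Complex.re_le_norm _).trans ?_)
      rw [norm_mul, norm_mul, norm_mul, norm_mul, Complex.norm_I, Complex.norm_real,
        Real.norm_of_nonneg Real.pi_pos.le, Complex.norm_ofNat, mul_one]
      gcongr
    · rw [Complex.norm_exp]
      refine Real.exp_le_exp.mpr ?_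
      have : (2 * Real.pi * Complex.I * τ * n).re = -(2 * Real.pi * n) * τ.im := by
        simp; ring
      rw [this]
      have hn : 0 ≤ 2 * Real.pi * n := by positivity
      nlinarith
  refine (mul_le_mul h1 h2 (norm_nonneg _) (by positivity)).trans_eq ?_
  rw [characterBound]
  ring_nf

theorem differentiable_characterTerm {r : ℕ} (b : Fin r → WeightOne V) (ν : ℂ) :
    Differentiable ℂ fun p : (Fin r → ℂ) × ℂ => characterTerm M (∑ i, p.1 i • b i) p.2 ν := by
  let A : (Fin r → ℂ) →ₗ[ℂ] Module.End ℂ (weightSpace V M ν) :=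
    (2 * Real.pi * Complex.I : ℂ) • (zeroModeLinear M ν ∘ₗ Fintype.linearCombination ℂ b)
  have hA := differentiable_trace_expEnd A
  have h1 : Differentiable ℂ fun p : (Fin r → ℂ) × ℂ =>
      LinearMap.trace ℂ _ (expEnd (A p.1)) := hA.comp differentiable_fst
  have h2 : Differentiable ℂ fun p : (Fin r → ℂ) × ℂ =>
      Complex.exp (2 * Real.pi * Complex.I * p.2 * (ν - centralCharge V / 24)) := by fun_prop
  exact h1.mul h2

theorem summable_characterTerm
    (h : ∀ n : ℕ, weightSpace V M (μ + n) = reducedSpan V (weightSpace V M μ) K n)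
    (h0 : ∀ ν, (∀ n : ℕ, μ + n ≠ ν) → weightSpace V M ν = ⊥)
    (a : WeightOne V) {τ : ℂ} (hτ : 0 < τ.im) :
    Summable (characterTerm M a τ) := by
  obtain ⟨C, hC0, hC⟩ := exists_zeroModeBound (M := M) (K := K) (μ := μ) a
  have hinj : Function.Injective fun n : ℕ => μ + n := fun m n hmn => by
    exact_mod_cast add_left_cancel hmn
  -- The series runs over all complex weights but is supported on `μ + ℕ`.
  rw [← hinj.summable_iff fun ν hν => characterTerm_eq_zero (h0 ν fun n hn => hν ⟨n, hn⟩)]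
  exact Summable.of_norm_bounded (summable_characterBound (T := ‖τ‖) hC0 hτ) fun n =>
    norm_characterTerm_le hC0 hC le_rfl le_rfl (h n)

theorem differentiableOn_character
    (h : ∀ n : ℕ, weightSpace V M (μ + n) = reducedSpan V (weightSpace V M μ) K n)
    (h0 : ∀ ν, (∀ n : ℕ, μ + n ≠ ν) → weightSpace V M ν = ⊥)
    {r : ℕ} (b : Fin r → WeightOne V) :
    DifferentiableOn ℂ (fun p : (Fin r → ℂ) × ℂ => character M (∑ i, p.1 i • b i) p.2)
      {p | 0 < p.2.im} := by
  have hinj : Function.Injective fun n : ℕ => μ + n := fun m n hmn => by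
    exact_mod_cast add_left_cancel hmn
  have hsum : ∀ (a : WeightOne V) (τ : ℂ), character M a τ = ∑' n : ℕ, characterTerm M a τ (μ + n) :=
    fun a τ => (hinj.tsum_eq fun ν hν => by
      by_contra hn
      exact hν (characterTerm_eq_zero (h0 ν fun n hn' => hn ⟨n, hn'⟩))).symm
  simp only [hsum]
  choose C hC0 hC using fun i => exists_zeroModeBound (M := M) (K := K) (μ := μ) (b i)
  refine differentiableOn_tsum_of_locally_bounded
    (fun n => (differentiable_characterTerm b _).differentiableOn) fun p hp => ?_
  have hp' : 0 < p.2.im := hp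
  have hsumC : 0 ≤ ∑ i, (‖p.1‖ + 1) * C i :=
    Finset.sum_nonneg fun i _ => mul_nonneg (by positivity) (hC0 i)
  -- On this neighbourhood the coordinates are at most `‖p.1‖ + 1`, so a single zero mode bound
  -- serves for all vectors, and `Im τ` stays away from zero.
  refine ⟨{q | ‖q.1‖ < ‖p.1‖ + 1 ∧ ‖q.2‖ < ‖p.2‖ + 1 ∧ p.2.im / 2 < q.2.im}, ?_, ?_,
    characterBound (V := V) M K μ (∑ i, (‖p.1‖ + 1) * C i) (‖p.2‖ + 1) (p.2.im / 2),
    summable_characterBound hsumC (by positivity), fun n q hq => ?_⟩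
  · refine IsOpen.mem_nhds ?_ ⟨by linarith, by linarith, by linarith⟩
    exact (isOpen_lt continuous_fst.norm continuous_const).inter
      ((isOpen_lt continuous_snd.norm continuous_const).inter
        (isOpen_lt continuous_const (Complex.continuous_im.comp continuous_snd)))
  · rintro q ⟨-, -, hq⟩
    exact lt_trans (by positivity) hq
  · obtain ⟨hq1, hq2, hq3⟩ := hq
    refine norm_characterTerm_le hsumC (ZeroModeBound.sum fun i _ => ?_) hq2.le hq3.le (h n)
    refine ((hC i).smul (q.1 i)).mono (mul_le_mul_of_nonneg_right ?_ (hC0 i))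
    exact (norm_le_pi_norm q.1 i).trans hq1.le

end VOA

end

theorem proposition1p1 {V : Type*} [AddCommGroup V] [Module ℂ V] [VertexOperatorAlgebra V]
    [VOA.IsStronglyRational V] {M : Type*} [AddCommGroup M] [Module ℂ M] [VOAModule V M]
    [VOA.IsOrdinaryModule V M] (hM : VOA.IsIrreducibleModule V M)
    (𝔥 : LieSubalgebra ℂ (VOA.WeightOne V)) (h𝔥 : 𝔥.IsCartanSubalgebra) :
    (∀ (x : 𝔥) (τ : ℂ), 0 < τ.im → Summable (VOA.characterTerm M (x : VOA.WeightOne V) τ)) ∧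
    HolomorphicOnProdUpperHalfPlane
      (fun (x : 𝔥) (τ : ℂ) => VOA.character M (x : VOA.WeightOne V) τ) := by
  have := VOA.IsStronglyRational.C₂_cofinite (V := V)
  obtain ⟨K, μ, h, h0⟩ := VOA.exists_weightSpace_eq_reducedSpan (V := V) hM
  refine ⟨fun x τ hτ => VOA.summable_characterTerm h h0 x hτ,
    inferInstanceAs (Module.Finite ℂ 𝔥.toSubmodule), fun r b => ?_⟩
  -- The basis of `𝔥` enters as a finite family in `V_1`; the coordinates then depend only on the
  -- inclusion being linear.
  have := VOA.differentiableOn_character h h0 fun i => (b i : VOA.WeightOne V)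
  convert this using 3 with p
  exact map_sum 𝔥.toSubmodule.subtype _ _
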